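/- Let $r\ge 2$, let $A=\{a_1,\dots,a_r\}$ and let $F_r=F(A)$ be the free group with free basis $A$. **Primitivity rank.** An element of a free group $H$ is primitive in $H$ if it belongs to some free basis of $H$. For $1\ne w\in F_r$, the primitivity rank $\pi(w)$ is the smallest rank of a subgroup $H\le F_r$ that contains $w$ as a non-primitive element ($\pi(w)=\infty$ if there is none), and $Crit(w)$ is the set of all subgroups $H\le F_r$ of rank $\pi(w)$ that contain $w$ as a non-primitive element. **$A$-graphs.** An $A$-graph is a graph in which every oriented edge $e$ carries a label in $A^{\pm1}$, with $e^{-1}$ carrying the inverse of the label of $e$. It is folded if distinct oriented edges with the same initial vertex have distinct labels. The number of edges counts each pair $e,e^{-1}$ once, and the degree of a vertex is the number of oriented edges starting at it. **Readability.** Let $0<\mu\le 1$, let $L\ge 2$ be an integer and let $v$ be a nontrivial freely reduced word. - $v$ is $\mu$-readable if it labels a reduced path in some connected folded $A$-graph $\Gamma$ with at most $\mu|v|$ edges and with $\pi_1(\Gamma)$ of rank at most $r-1$. - $v$ is $(\mu,L)$-readable if it labels a path in some connected folded $A$-graph $\Gamma$ with at most $\mu|v|$ edges, with $\pi_1(\Gamma)$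 of rank at most $L$, and with at least one vertex of degree less than $2r$. **The set $P'(\lambda,\mu,L)$.** This is the set of all cyclically reduced words $w\in F_r$ such that 1. the symmetrized closure of $w$ (all cyclic permutations of $w^{\pm1}$) satisfies the small cancellation condition $C'(\lambda)$: whenever $u$ is a common initial segment of two distinct elements of the closure and $u$ is an initial segment of an element $v$ of the closure, then $|u|<\lambda|v|$; 2. $w$ is not a proper power in $F_r$; 3. every subword $w'$ of a cyclic permutation of $w$ with $|w'|\ge |w|/2$ is neither $\mu$-readable nor $(\mu,L)$-readable; 4. every freely reduced word of length $2$ in $F_r$ occurs as a subword of $w$. **Theorem.** Let $r\ge 2$ and let $0<\lambda<1$ and $0<\mu<1$ satisfy $$\lambda\le\frac{\mu}{15r+3\mu}<\frac16\qquad\text{and}\qquad \lambda<\frac{\mu}{3r}.$$ Then for every nontrivial cyclically reduced word $w\in P'(\lambda,\mu,r)$ we have $$\pi(w)=r\qquad\text{and}\qquad Crit(w)=\{F_r\}.$$ -/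

import Mathlib

universe u

namespace PrimitivityRank

/-! ### Free rank, primitive elements, primitivity rank, critical set -/

/-- `g` is primitive in `G` if it belongs to some free basis of `G`. -/
def IsPrimitive {G : Type u} [Group G] (g : G) : Prop :=
  ∃ (ι : Type u) (b : FreeGroupBasis ι G) (i : ι), b i = g

/-- The rank of a free group: the cardinality of a free basis. All free bases of `G` have the
same cardinality, see `freeRank_eq`, so that the infimum below runs over one number only
(and the value is `⊤` if that cardinality is infinite). -/
noncomputable def freeRank (G : Type u) [Group G] : ℕ∞ :=
  sInf {n : ℕ∞ | ∃ ι : Type u, Nonempty (FreeGroupBasis ι G) ∧ ENat.card ι = n}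

theorem freeRank_eq {G : Type u} [Group G] {ι : Type u} (b : FreeGroupBasis ι G) :
    freeRank G = ENat.card ι := by
  have h : {n : ℕ∞ | ∃ κ : Type u, Nonempty (FreeGroupBasis κ G) ∧ ENat.card κ = n}
      = {ENat.card ι} := by
    ext n
    constructor
    · rintro ⟨κ, ⟨c⟩, rfl⟩
      exact ENat.card_congr (Equiv.ofFreeGroupEquiv (c.repr.symm.trans b.repr))
    · rintro rfl
      exact ⟨ι, ⟨b⟩, rfl⟩
  rw [freeRank, h, sInf_singleton]

/-- `H` contains `g`, and `g` is not primitive in `H`. -/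
def ContainsNonprimitively {G : Type u} [Group G] (H : Subgroup G) (g : G) : Prop :=
  ∃ hg : g ∈ H, ¬ IsPrimitive (⟨g, hg⟩ : H)

/-- The primitivity rank `π(g)`: the smallest rank of a subgroup containing `g` as a
non-primitive element, and `∞` if there is no such subgroup. -/
noncomputable def primitivityRank {G : Type u} [Group G] (g : G) : ℕ∞ :=
  sInf {n : ℕ∞ | ∃ H : Subgroup G, ContainsNonprimitively H g ∧ freeRank H = n}

/-- The critical set `Crit(g)`: all subgroups of rank `π(g)` containing `g` as a
non-primitive element. -/
def criticalSet {G : Type u} [Group G] (g : G) : Set (Subgroup G) :=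
  {H | ContainsNonprimitively H g ∧ freeRank H = primitivityRank g}

/-! ### `A`-graphs

A letter of `A^{±1}` is a pair `(a, ε) : α × Bool`, as in `FreeGroup α`: the pair `(a, true)` is
the letter `a`, and `(a, false)` is `a⁻¹`. -/

/-- An `A`-graph. Each topological edge is given once, with the orientation in which its label is
in `A`. The oriented edges of the graph are the arrows of `Quiver.Symmetrify V`, that is the given
edges together with their formal inverses. -/
structure AGraph (α : Type) where
  /-- the vertices -/
  V : Type
  /-- the topological edges, oriented so that the label is in `A` -/
  [quiver : Quiver.{0} V]
  /-- the label of a topological edge so oriented -/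
  posLabel : ∀ {x y : V}, (x ⟶ y) → α

attribute [instance] AGraph.quiver

namespace AGraph

variable {α : Type} (Γ : AGraph α)

/-- Vertices, with the oriented edges (in both directions) as arrows. -/
abbrev Vertex : Type := Quiver.Symmetrify Γ.V

/-- Edge-paths: they traverse edges in either direction. -/
abbrev EdgePath (x y : Γ.Vertex) : Type := Quiver.Path x y

/-- The label in `A^{±1}` of an oriented edge. -/
def label {x y : Γ.Vertex} : (x ⟶ y) → α × Bool :=
  Sum.elim (fun e => (Γ.posLabel e, true)) (fun e => (Γ.posLabel e, false))

/-- The label of an edge-path, a word in `A^{±1}`. -/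
def pathLabel {x : Γ.Vertex} : ∀ {y : Γ.Vertex}, Γ.EdgePath x y → List (α × Bool)
  | _, .nil => []
  | _, .cons p e => pathLabel p ++ [Γ.label e]

/-- An edge-path is reduced if it nowhere traverses `e` and then immediately `e⁻¹`. -/
def IsReducedPath {x y : Γ.Vertex} (p : Γ.EdgePath x y) : Prop :=
  ∀ (a b : Γ.Vertex) (q : Γ.EdgePath x a) (e : a ⟶ b) (s : Γ.EdgePath a y),
    p ≠ ((q.cons e).cons (Quiver.reverse e)).comp s

/-- Any two vertices are joined by an edge-path. -/
def Connected : Prop :=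
  Nonempty Γ.Vertex ∧ ∀ x y : Γ.Vertex, Nonempty (Γ.EdgePath x y)

/-- Distinct oriented edges with the same initial vertex have distinct labels. -/
def Folded : Prop :=
  ∀ x : Γ.Vertex, Function.Injective fun e : Quiver.Star x => Γ.label e.2

/-- The number of topological edges (`⊤` if infinite). -/
noncomputable def numEdges : ℕ∞ := ENat.card (Quiver.Total Γ.V)

/-- The degree of a vertex: the number of oriented edges issuing from it. -/
noncomputable def degree (x : Γ.Vertex) : ℕ∞ := ENat.card (Quiver.Star x)

/-- The fundamental group `π₁(Γ, x)`: closed edge-paths at `x` modulo insertion and deletion of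
subpaths `e e⁻¹`, that is the vertex group at `x` of the free groupoid on the graph. -/
abbrev fundamentalGroup (x : Γ.Vertex) : Type :=
  CategoryTheory.End ((Quiver.FreeGroupoid.of Γ.V).obj x)

end AGraph

/-! ### Readability -/

/-- A nontrivial freely reduced word `w` in `F(a_1, …, a_r)` is `μ`-readable: it labels a reduced
path in a connected folded `A`-graph with at most `μ |w|` edges and fundamental group of rank at
most `r - 1`. (By connectedness, the choice of the base vertex `x` is immaterial.) -/
def IsReadable {r : ℕ} (μ : ℝ) (w : List (Fin r × Bool)) : Prop :=
  ∃ Γ : AGraph (Fin r), Γ.Connected ∧ Γ.Folded ∧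
    (∃ m : ℕ, Γ.numEdges = m ∧ (m : ℝ) ≤ μ * w.length) ∧
    ∃ (x y : Γ.Vertex) (p : Γ.EdgePath x y),
      freeRank (Γ.fundamentalGroup x) ≤ ((r - 1 : ℕ) : ℕ∞) ∧
      Γ.IsReducedPath p ∧ Γ.pathLabel p = w

/-- A nontrivial freely reduced word `w` in `F(a_1, …, a_r)` is `(μ, L)`-readable: it labels a
path in a connected folded `A`-graph with at most `μ |w|` edges, fundamental group of rank at
most `L`, and some vertex of degree less than `2r`. -/
def IsReadableWith {r : ℕ} (μ : ℝ) (L : ℕ) (w : List (Fin r × Bool)) : Prop :=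
  ∃ Γ : AGraph (Fin r), Γ.Connected ∧ Γ.Folded ∧
    (∃ m : ℕ, Γ.numEdges = m ∧ (m : ℝ) ≤ μ * w.length) ∧
    (∃ (x y : Γ.Vertex) (p : Γ.EdgePath x y),
      freeRank (Γ.fundamentalGroup x) ≤ (L : ℕ∞) ∧ Γ.pathLabel p = w) ∧
    ∃ v : Γ.Vertex, Γ.degree v < ((2 * r : ℕ) : ℕ∞)

/-! ### Small cancellation and the sets `P(λ, μ, L)`, `P'(λ, μ, L)` -/

/-- The symmetrized closure of a cyclically reduced word `w`: all cyclic permutations of `w` and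
of `w⁻¹`. -/
def symmetrizedClosure {α : Type} (w : List (α × Bool)) : Set (List (α × Bool)) :=
  {v | v ~r w ∨ v ~r FreeGroup.invRev w}

/-- A piece: a common initial segment of two distinct elements of `R`. -/
def IsPiece {α : Type} (R : Set (List (α × Bool))) (u : List (α × Bool)) : Prop :=
  ∃ v₁ ∈ R, ∃ v₂ ∈ R, v₁ ≠ v₂ ∧ u <+: v₁ ∧ u <+: v₂

/-- The metric small cancellation condition `C'(lam)` for a symmetrized set `R`. -/
def SmallCancellation {α : Type} (lam : ℝ) (R : Set (List (α × Bool))) : Prop :=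
  ∀ v ∈ R, ∀ u, u <+: v → IsPiece R u → (u.length : ℝ) < lam * v.length

/-- `w` is a proper power. -/
def IsProperPower {G : Type u} [Group G] (w : G) : Prop :=
  ∃ (v : G) (n : ℕ), 2 ≤ n ∧ w = v ^ n

/-- The set `P(lam, μ, L)` of cyclically reduced words satisfying the `(lam, μ, L)`-condition. -/
def setP (r : ℕ) (lam μ : ℝ) (L : ℕ) : Set (FreeGroup (Fin r)) :=
  {w | FreeGroup.IsCyclicallyReduced w.toWord ∧
    SmallCancellation lam (symmetrizedClosure w.toWord) ∧
    ¬ IsProperPower w ∧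
    ∀ v w' : List (Fin r × Bool), v ~r w.toWord → w' <:+: v →
      (w.toWord.length : ℝ) / 2 ≤ w'.length →
      ¬ IsReadable μ w' ∧ ¬ IsReadableWith μ L w'}

/-- The set `P'(lam, μ, L)` of the words in `P(lam, μ, L)` in which every freely reduced word of
length two occurs as a subword. -/
def setP' (r : ℕ) (lam μ : ℝ) (L : ℕ) : Set (FreeGroup (Fin r)) :=
  {w | w ∈ setP r lam μ L ∧
    ∀ z : List (Fin r × Bool), FreeGroup.IsReduced z → z.length = 2 → z <:+: w.toWord}

end PrimitivityRank

/-!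
Let `H` be a subgroup of rank at most `r` containing `w`, and read the word `w` as a loop at the
base vertex of the Schreier graph of `H`. Let `Γ` be the image of this loop.

* If some edge of `Γ` is crossed only once by the loop, then `w` is primitive in `H`: the loops of
  the Schreier graph avoiding that edge form a free group, and `w` extends a basis of it to a basis
  of `H` (`isPrimitive_of_edge_crossed_once`). So suppose that every edge is crossed at least twice.
* `Γ` is a subgraph of the Schreier graph of `H`, so that its first Betti number and the rank of
  its fundamental group are at most `r` (`card_edges_add_one_le`, `freeRank_fundamentalGroup_le`).
* Every arc of `Γ` is crossed twice, so its label is a piece, and thus shorter than `lam * |w|`.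
  Since all degrees are at least two, at most `6 (r - 1)` oriented edges issue from branch vertices,
  and so there are at most `3 (r - 1)` arcs. Therefore `Γ` has at most `μ * |w|` edges, as
  `lam < μ / (3 r)` (`exists_card_edges_loop_le`).
* As `w` is not `(μ, r)`-readable, all vertices of `Γ` must have degree `2 r`. Then `E = r V`, and
  `E - V + 1 ≤ r` forces `V = 1`, whence `H` is the whole group
  (`eq_top_of_containsNonprimitively`).

It remains to see that `w` is not primitive in the free group itself. This is the case of complete
Whitehead graph of Whitehead's cut vertex lemma, proved here with almost invariant sets
(`not_isPrimitive_of_two_letter_words`): were `w` a member of a basis, then the set of elements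
whose normal form starts with another basis element would be invariant under right multiplication
by `w` and have finite coboundary in the Cayley tree, without being finite or cofinite. But the
translates of the axis of `w` pass through all turns of the Cayley tree, and so no such set exists.

Homomorphisms out of `H` are built from cocycles on the Schreier graph (`transport`), which may be
prescribed arbitrarily on edges; this takes the place of spanning trees.
-/

namespace PrimitivityRank

open FreeGroup

/-! ### Words containing every reduced word of length two are not primitive -/

section Cones

variable {α : Type*}

/-- The inverse letter. -/
def invLetter (x : α × Bool) : α × Bool := (x.1, !x.2)

@[simp] theorem invLetter_invLetter (x : α × Bool) : invLetter (invLetter x) = x := by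
  simp [invLetter]

theorem mk_cons (x : α × Bool) (l : List (α × Bool)) : mk (x :: l) = mk [x] * mk l := by
  rw [mul_mk]; rfl

theorem mk_invLetter (x : α × Bool) : mk [invLetter x] = (mk [x])⁻¹ := by
  rw [inv_mk]; simp [invRev, invLetter]

theorem isReduced_invRev {l : List (α × Bool)} (h : IsReduced l) : IsReduced (invRev l) := by
  classical
  rw [isReduced_iff_reduce_eq] at h ⊢
  rw [reduce_invRev, h]

theorem isReduced_pair_iff {x y : α × Bool} : IsReduced [x, y] ↔ y ≠ invLetter x := by
  obtain ⟨a, b⟩ := x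
  obtain ⟨c, d⟩ := y
  simp only [isReduced_cons_cons, IsReduced.singleton, and_true, invLetter, ne_eq,
    Prod.mk.injEq, not_and]
  constructor
  · rintro h rfl rfl
    simpa using h rfl
  · rintro h rfl
    have := h rfl
    cases b <;> cases d <;> simp_all

variable [DecidableEq α]

/-- A colouring `χ` of a free group that is unchanged along all but finitely many edges of the
Cayley tree is constant on cones far from `1`. -/
theorem cone_eq {χ : FreeGroup α → Prop} {N : ℕ}
    (hN : ∀ g : FreeGroup α, N ≤ g.toWord.length → ∀ x : α × Bool, χ (g * mk [x]) = χ g)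
    (u t : List (α × Bool)) (hu : N ≤ u.length) (hr : IsReduced (u ++ t)) :
    χ (mk (u ++ t)) = χ (mk u) := by
  induction t using List.reverseRecOn with
  | nil => simp
  | append_singleton t x ih =>
    rw [← List.append_assoc] at hr ⊢
    have hr' : IsReduced (u ++ t) := hr.infix ⟨[], [x], by simp⟩
    rw [← ih hr', ← mul_mk]
    apply hN
    rw [toWord_mk, hr'.reduce_eq, List.length_append]
    omega

/-- If `w` contains every reduced word of length two, then at each vertex of the Cayley tree any
two outgoing edges `x ≠ y` are the first edges of two long rays lying on one translate of the axis
of `w`; a `w`-invariant colouring takes the same value far out on both. -/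
theorem exists_rays {w : FreeGroup α} (hwc : IsCyclicallyReduced w.toWord)
    (hw : ∀ z : List (α × Bool), IsReduced z → z.length = 2 → z <:+: w.toWord)
    {χ : FreeGroup α → Prop} (hχ : ∀ g, χ (g * w) = χ g) (N : ℕ)
    {g : List (α × Bool)} {x y : α × Bool} (hxy : x ≠ y)
    (hx : IsReduced (g ++ [x])) (hy : IsReduced (g ++ [y])) :
    ∃ s t : List (α × Bool), IsReduced (g ++ [x] ++ s) ∧ IsReduced (g ++ [y] ++ t) ∧
      N ≤ s.length ∧ N ≤ t.length ∧ χ (mk (g ++ [x] ++ s)) = χ (mk (g ++ [y] ++ t)) := by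
  obtain ⟨p, q, hpq⟩ := hw [invLetter x, y] (isReduced_pair_iff.2 (by simpa using hxy.symm)) rfl
  set L := w.toWord with hL
  set W := (List.replicate N L).flatten with hW
  have hWlen : N ≤ W.length := by
    have h1 : 1 ≤ L.length := by rw [← hpq]; simp; omega
    simp only [hW, List.length_flatten, List.map_replicate, List.sum_replicate, smul_eq_mul]
    nlinarith
  have hmkL : mk L = w := mk_toWord
  have hmkW : mk W = w ^ N := by rw [hW, ← pow_mk, hmkL]
  have h1 : IsReduced (L ++ W) := by
    have := (hwc.flatten_replicate (N + 1)).isReduced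
    rwa [List.replicate_succ, List.flatten_cons] at this
  have h2 : IsReduced (W ++ L) := by
    have := (hwc.flatten_replicate (N + 1)).isReduced
    rwa [List.replicate_succ', List.flatten_append, List.flatten_singleton] at this
  -- with `w = p x⁻¹ y q`, the axis through the turn at `g` runs from `g x p⁻¹ w⁻ᴺ` to `g y q wᴺ`
  refine ⟨invRev p ++ invRev W, q ++ W, ?_, ?_, ?_, ?_, ?_⟩
  · refine hx.append_overlap ?_ (by simp)
    have h3 : IsReduced (W ++ p ++ [invLetter x]) := h2.infix ⟨[], y :: q, by simp [← hpq]⟩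
    have h4 := isReduced_invRev h3
    simpa [invRev_append, invRev, invLetter] using h4
  · refine hy.append_overlap ?_ (by simp)
    exact h1.infix ⟨p ++ [invLetter x], [], by simp [← hpq]⟩
  · simp; omega
  · simp; omega
  · have hinv : ∀ (k : ℕ) g, χ (g * w ^ k) = χ g := by
      intro k
      induction k with
      | zero => simp
      | succ k ih => intro g; rw [pow_succ, ← mul_assoc, hχ, ih]
    rw [← hinv (N + 1 + N)]
    congr 1
    simp only [← mul_mk, ← inv_mk, hmkW]
    have h5 : mk [x] * (mk p)⁻¹ * w = mk [y] * mk q := by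
      rw [← hmkL, ← hpq]
      simp only [← mul_mk, mk_cons (invLetter x) [y], mk_invLetter]
      group
    rw [pow_add, pow_succ']
    calc _ = mk g * (mk [x] * (mk p)⁻¹ * w) * w ^ N := by group
      _ = _ := by rw [h5]; group

/-- Far from `1`, a `w`-invariant colouring is constant on every cone of the Cayley tree, if `w`
contains every reduced word of length two. The induction proceeds from far cones inwards. -/
theorem cone_const {w : FreeGroup α} (hwc : IsCyclicallyReduced w.toWord)
    (hw : ∀ z : List (α × Bool), IsReduced z → z.length = 2 → z <:+: w.toWord)
    {χ : FreeGroup α → Prop} (hχ : ∀ g, χ (g * w) = χ g) {N : ℕ}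
    (hN : ∀ g : FreeGroup α, N ≤ g.toWord.length → ∀ x : α × Bool, χ (g * mk [x]) = χ g)
    (k : ℕ) : ∀ g : List (α × Bool), N ≤ g.length + k →
      ∃ c : Prop, ∀ u, IsReduced (g ++ u) → N ≤ (g ++ u).length → χ (mk (g ++ u)) = c := by
  induction k with
  | zero => exact fun g hg => ⟨χ (mk g), fun u hu _ => cone_eq hN g u (by omega) hu⟩
  | succ k ih =>
    intro g hg
    by_cases hgN : N ≤ g.length
    · exact ⟨χ (mk g), fun u hu _ => cone_eq hN g u hgN hu⟩
    choose c hc using fun x => ih (g ++ [x]) (by simp; omega)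
    have key : ∀ x y, IsReduced (g ++ [x]) → IsReduced (g ++ [y]) → c x = c y := by
      intro x y hx hy
      by_cases hxy : x = y
      · rw [hxy]
      obtain ⟨s, t, hs, ht, hsN, htN, hst⟩ := exists_rays hwc hw hχ N hxy hx hy
      rw [← hc x s hs (by simp; omega), ← hc y t ht (by simp; omega), hst]
    by_cases hex : ∃ x, IsReduced (g ++ [x])
    · obtain ⟨x, hx⟩ := hex
      refine ⟨c x, fun u hu hl => ?_⟩
      cases u with
      | nil => simp at hl; omega
      | cons y u =>
        have e : g ++ y :: u = g ++ [y] ++ u := by simp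
        rw [e] at hu hl ⊢
        rw [hc y u hu hl]
        exact key y x (hu.infix ⟨[], u, by simp⟩) hx
    · -- no reduced extension is long enough, and the colour is immaterial
      refine ⟨True, fun u hu hl => ?_⟩
      cases u with
      | nil => simp at hl; omega
      | cons y u => exact absurd ⟨y, hu.infix ⟨[], u, by simp⟩⟩ hex

/-- If a cyclically reduced `w` contains every reduced word of length two, then no `w`-invariant
colouring with finite coboundary separates the ends of the Cayley tree. -/
theorem finite_ne_of_invariant [Finite α] {w : FreeGroup α}
    (hwc : IsCyclicallyReduced w.toWord)
    (hw : ∀ z : List (α × Bool), IsReduced z → z.length = 2 → z <:+: w.toWord)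
    {χ : FreeGroup α → Prop} (hχ : ∀ g, χ (g * w) = χ g)
    (hfin : ∀ t, {g | χ (g * t) ≠ χ g}.Finite) :
    ∃ c : Prop, {g | χ g ≠ c}.Finite := by
  have hB : (⋃ x : α × Bool, {g | χ (g * mk [x]) ≠ χ g}).Finite :=
    Set.finite_iUnion fun x => hfin _
  obtain ⟨N, hN⟩ := (hB.image fun g => g.toWord.length).bddAbove
  have hN' : ∀ g : FreeGroup α, N + 1 ≤ g.toWord.length → ∀ x : α × Bool,
      χ (g * mk [x]) = χ g := by
    intro g hg x
    by_contra hne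
    have := hN ⟨g, Set.mem_iUnion.2 ⟨x, hne⟩, rfl⟩
    simp only at this
    omega
  obtain ⟨c, hc⟩ := cone_const hwc hw hχ hN' (N + 1) [] (by simp)
  refine ⟨c, ((List.finite_length_lt (α × Bool) (N + 1)).preimage
    (toWord_injective (α := α)).injOn).subset fun g hg => ?_⟩
  by_contra hlt
  apply hg
  have := hc g.toWord (by simpa using isReduced_toWord) (by simpa using hlt)
  rwa [List.nil_append, mk_toWord] at this

end Cones

section FirstLetter

variable {ι : Type*} [DecidableEq ι]

/-- Right multiplication by a letter keeps the first letter of the normal form, except across the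
edge of the Cayley tree joining `1` to the letter in question. -/
theorem head_toWord_mul_letter (a : ι × Bool) (h : FreeGroup ι) (x : ι × Bool)
    (h1 : h ≠ 1) (h2 : h ≠ mk [a]) :
    (h * mk [x]).toWord.head? = some a ↔ h.toWord.head? = some a := by
  rcases List.eq_nil_or_concat h.toWord with h0 | ⟨L, z, hz⟩
  · exact absurd (toWord_eq_nil_iff.1 h0) h1
  rw [List.concat_eq_append] at hz
  have hred : IsReduced (L ++ [z]) := hz ▸ isReduced_toWord
  have hmk : h = mk L * mk [z] := by rw [mul_mk, ← hz, mk_toWord]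
  by_cases hx : x = invLetter z
  · have e : h * mk [x] = mk L := by rw [hmk, hx, mk_invLetter]; group
    have hL : IsReduced L := hred.infix ⟨[], [z], by simp⟩
    rw [e, toWord_mk, hL.reduce_eq, hz]
    cases L with
    | nil =>
      have : z ≠ a := by rintro rfl; exact h2 (by rw [hmk]; exact one_mul _)
      simp [this]
    | cons b L => simp
  · have hr : IsReduced (L ++ [z] ++ [x]) :=
      hred.append_overlap (isReduced_pair_iff.2 hx) (by simp)
    rw [hmk, mul_mk, mul_mk, toWord_mk, hr.reduce_eq, toWord_mk, hred.reduce_eq]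
    cases L <;> simp

/-- The set of elements whose normal form begins with a given letter has finite coboundary in the
Cayley tree: only one edge joins it to its complement. -/
theorem finite_head_toWord_ne (a : ι × Bool) (t : FreeGroup ι) :
    {h : FreeGroup ι | ((h * t).toWord.head? = some a) ≠ (h.toWord.head? = some a)}.Finite := by
  have hlet : ∀ x : ι × Bool, {h : FreeGroup ι |
      ((h * mk [x]).toWord.head? = some a) ≠ (h.toWord.head? = some a)}.Finite := by
    intro x
    refine (Set.toFinite {1, mk [a]}).subset fun h hh => ?_
    by_contra hne
    simp only [Set.mem_insert_iff, Set.mem_singleton_iff, not_or] at hne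
    exact hh (propext (head_toWord_mul_letter a h x hne.1 hne.2))
  obtain ⟨l, rfl⟩ : ∃ l, mk l = t := ⟨t.toWord, mk_toWord⟩
  induction l with
  | nil => simp [← one_eq_mk]
  | cons x l ih =>
    refine ((hlet x).union (ih.preimage (mul_left_injective (mk [x])).injOn)).subset
      fun h hh => ?_
    by_contra hne
    simp only [Set.mem_union, Set.mem_ofPred_eq, Set.mem_preimage, not_or, not_not] at hne
    apply hh
    rw [mk_cons, ← mul_assoc, hne.2, hne.1]

theorem head_toWord_mul_of (i : ι) (h : FreeGroup ι) {j : ι} (hij : i ≠ j) :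
    ((h * of i).toWord.head? = some (j, true)) = (h.toWord.head? = some (j, true)) := by
  by_cases h1 : h = 1
  · subst h1; simp [hij]
  by_cases h2 : h = of j
  · subst h2
    have hr : IsReduced [(j, true), (i, true)] := isReduced_pair_iff.2 (by simp [invLetter])
    have : of j * of i = mk [(j, true), (i, true)] := by rw [of, of, mul_mk]; rfl
    rw [this, toWord_mk, hr.reduce_eq]
    simp
  · exact propext (head_toWord_mul_letter (j, true) h (i, true) h1 h2)

end FirstLetter

/-- **Whitehead.** In a free group of rank at least two, a cyclically reduced word that contains
every reduced word of length two is not primitive: if `w` belonged to a basis containing another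
element `b`, the elements with normal form starting with `b` would form a `w`-invariant set of
finite coboundary, neither finite nor cofinite. -/
theorem not_isPrimitive_of_two_letter_words {α : Type} [Finite α] [DecidableEq α] [Nontrivial α]
    {w : FreeGroup α} (hwc : IsCyclicallyReduced w.toWord)
    (hw : ∀ z : List (α × Bool), IsReduced z → z.length = 2 → z <:+: w.toWord) :
    ¬ IsPrimitive w := by
  classical
  rintro ⟨ι, b, i, rfl⟩
  have : Nontrivial ι := (Equiv.ofFreeGroupEquiv b.repr).symm.nontrivial
  obtain ⟨j, hij⟩ := exists_ne i
  obtain ⟨c, hc⟩ := finite_ne_of_invariant hwc hw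
    (χ := fun g => (b.repr g).toWord.head? = some (j, true))
    (fun g => by
      simp only [_root_.map_mul, FreeGroupBasis.repr_apply_coe]
      exact head_toWord_mul_of i _ hij.symm)
    (fun t => by
      simp only [_root_.map_mul]
      exact (finite_head_toWord_ne (j, true) (b.repr t)).preimage b.repr.injective.injOn)
  have hinj : ∀ k, Function.Injective fun n : ℕ => b.repr.symm (of k ^ (n + 1)) := by
    intro k m n hmn
    have := congrArg (fun g => g.toWord.length) (b.repr.symm.injective hmn)
    simpa [toWord_of_pow] using this
  by_cases hcT : c
  · refine Set.infinite_range_of_injective (hinj i) (hc.subset ?_)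
    rintro _ ⟨n, rfl⟩
    simp [toWord_of_pow, List.replicate_succ, hcT, hij.symm]
  · refine Set.infinite_range_of_injective (hinj j) (hc.subset ?_)
    rintro _ ⟨n, rfl⟩
    simp [toWord_of_pow, List.replicate_succ, hcT]

/-! ### Paths in Schreier graphs and cocycles -/

section Cocycles

variable {α X : Type*} [MulAction (FreeGroup α) X]

/-- The vertex reached from `v` along the letter `x`. In the Schreier graph of an action of
`FreeGroup α` on `X`, the edge labelled `a` at `v` leads from `v` to `a⁻¹ • v`; so the path labelled
`l` from `v` ends at `(mk l)⁻¹ • v`. -/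
def step (v : X) (x : α × Bool) : X := (mk [x])⁻¹ • v

/-- The topological edge traversed by the letter `x` read from `v`; the pair `(u, a)` stands for
the edge labelled `a` from `u` to `a⁻¹ • u`. -/
def edgeOf (v : X) (x : α × Bool) : X × α := (if x.2 then v else step v x, x.1)

/-- The topological edges traversed by the path labelled `l` from `v`. -/
def edges : X → List (α × Bool) → List (X × α)
  | _, [] => []
  | v, x :: l => edgeOf v x :: edges (step v x) l

theorem mk_cons_inv_smul (v : X) (x : α × Bool) (l : List (α × Bool)) :
    (mk (x :: l))⁻¹ • v = (mk l)⁻¹ • step v x := by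
  rw [mk_cons, mul_inv_rev, mul_smul, step]

theorem step_true (v : X) (a : α) : step v (a, true) = (of a)⁻¹ • v := rfl

theorem step_false (v : X) (a : α) : step v (a, false) = of a • v := by
  have : (mk [(a, false)]) = (of a)⁻¹ := mk_invLetter (a, true)
  rw [step, this, inv_inv]

@[simp] theorem step_step_invLetter (v : X) (x : α × Bool) : step (step v x) (invLetter x) = v := by
  rw [step, step, mk_invLetter, inv_inv, smul_inv_smul]

theorem edgeOf_step_invLetter (v : X) (x : α × Bool) :
    edgeOf (step v x) (invLetter x) = edgeOf v x := by
  rw [edgeOf, step_step_invLetter]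
  obtain ⟨a, b⟩ := x
  cases b <;> rfl

theorem eq_or_of_edgeOf_eq {u v : X} {x y : α × Bool} (h : edgeOf u x = edgeOf v y) :
    (u = v ∧ x = y) ∨ (v = step u x ∧ y = invLetter x) := by
  obtain ⟨a, b⟩ := x
  obtain ⟨c, d⟩ := y
  simp only [edgeOf, Prod.mk.injEq] at h
  obtain ⟨h, rfl⟩ := h
  cases b <;> cases d
  · left
    simpa [step] using h
  · right
    exact ⟨by simpa using h.symm, rfl⟩
  · right
    simp only [if_true, Bool.false_eq_true, if_false] at h
    exact ⟨by rw [h]; simpa [invLetter] using (step_step_invLetter v (a, false)).symm, rfl⟩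
  · left
    simpa using h

theorem edges_append (v : X) (l l' : List (α × Bool)) :
    edges v (l ++ l') = edges v l ++ edges ((mk l)⁻¹ • v) l' := by
  induction l generalizing v with
  | nil => simp [edges, ← one_eq_mk]
  | cons x l ih => rw [List.cons_append, edges, ih, edges, mk_cons_inv_smul, List.cons_append]

theorem edges_invRev (v : X) (l : List (α × Bool)) :
    edges ((mk l)⁻¹ • v) (invRev l) = (edges v l).reverse := by
  induction l generalizing v with
  | nil => rfl
  | cons x l ih =>
    have : invRev [x] = [invLetter x] := rfl
    rw [mk_cons_inv_smul, invRev_cons, edges_append, ih, ← inv_mk, inv_inv, smul_inv_smul, this]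
    simp [edges, edgeOf_step_invLetter]

variable {P Q : Type*} [Group P] [Group Q]

/-- The unique cocycle `FreeGroup α → (X → P)` with prescribed values on the basis: the product of
the elements `f e ^ (±1)` over the edges `e` of the path labelled `g` from `v`. -/
def transport (f : X × α → P) (g : FreeGroup α) (v : X) : P :=
  (lift (fun a => (⟨fun v => f (v, a), of a⟩ :
    (X → P) ⋊[mulAutArrow] FreeGroup α)) g).left v

theorem transport_one (f : X × α → P) (v : X) : transport f 1 v = 1 := by
  simp [transport]

theorem transport_mul (f : X × α → P) (g h : FreeGroup α) (v : X) :
    transport f (g * h) v = transport f g v * transport f h (g⁻¹ • v) := by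
  have hr : ∀ g, (lift (fun a => (⟨fun v => f (v, a), of a⟩ :
      (X → P) ⋊[mulAutArrow] FreeGroup α)) g).right = g := by
    intro g
    have : (SemidirectProduct.rightHom.comp (lift (fun a => (⟨fun v => f (v, a), of a⟩ :
      (X → P) ⋊[mulAutArrow] FreeGroup α)))) = MonoidHom.id _ := by
      ext a; simp
    exact DFunLike.congr_fun this g
  simp only [transport, _root_.map_mul, SemidirectProduct.mul_left, Pi.mul_apply, hr]
  rfl

@[simp] theorem transport_of (f : X × α → P) (a : α) (v : X) :
    transport f (of a) v = f (v, a) := by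
  simp [transport]

theorem transport_inv (f : X × α → P) (g : FreeGroup α) (v : X) :
    transport f g⁻¹ (g⁻¹ • v) = (transport f g v)⁻¹ := by
  rw [eq_inv_iff_mul_eq_one, ← transport_one f (g⁻¹ • v), ← inv_mul_cancel g, transport_mul]
  simp

theorem transport_letter (f : X × α → P) (x : α × Bool) (v : X) :
    transport f (mk [x]) v = if x.2 then f (edgeOf v x) else (f (edgeOf v x))⁻¹ := by
  obtain ⟨a, b⟩ := x
  cases b
  · have : (mk [(a, false)]) = (of a)⁻¹ := mk_invLetter (a, true)
    have h := transport_inv f (of a) (step v (a, false))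
    rw [step_false, inv_smul_smul, transport_of] at h
    simp [this, h, edgeOf, step_false]
  · exact transport_of f a v

theorem transport_cons (f : X × α → P) (x : α × Bool) (l : List (α × Bool)) (v : X) :
    transport f (mk (x :: l)) v = transport f (mk [x]) v * transport f (mk l) (step v x) := by
  rw [mk_cons, transport_mul, step]

theorem transport_congr {f f' : X × α → P} {l : List (α × Bool)} {v : X}
    (h : ∀ e ∈ edges v l, f e = f' e) : transport f (mk l) v = transport f' (mk l) v := by
  induction l generalizing v with
  | nil => simp [← one_eq_mk, transport_one]
  | cons x l ih =>
    simp only [edges, List.mem_cons, forall_eq_or_imp] at h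
    rw [transport_cons, transport_cons f', ih h.2, transport_letter, transport_letter, h.1]

theorem map_transport (φ : P →* Q) (f : X × α → P) (g : FreeGroup α) (v : X) :
    φ (transport f g v) = transport (φ ∘ f) g v := by
  obtain ⟨l, rfl⟩ : ∃ l, mk l = g := Quot.exists_rep g
  induction l generalizing v with
  | nil => simp [← one_eq_mk, transport_one]
  | cons x l ih =>
    rw [transport_cons, transport_cons (φ ∘ f), _root_.map_mul, ih, transport_letter,
      transport_letter]
    split_ifs <;> simp

/-- The cocycle that sends every edge to its loop, formed with connecting paths `q`, sends every
path to its loop. -/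
theorem transport_coboundary (q : X → FreeGroup α) (g : FreeGroup α) (v : X) :
    transport (fun e : X × α => q e.1 * of e.2 * (q (step e.1 (e.2, true)))⁻¹) g v
      = q v * g * (q (g⁻¹ • v))⁻¹ := by
  obtain ⟨l, rfl⟩ : ∃ l, mk l = g := Quot.exists_rep g
  induction l generalizing v with
  | nil => simp [← one_eq_mk, transport_one]
  | cons x l ih =>
    have hx : transport (fun e : X × α => q e.1 * of e.2 * (q (step e.1 (e.2, true)))⁻¹) (mk [x]) v
        = q v * mk [x] * (q (step v x))⁻¹ := by
      obtain ⟨a, b⟩ := x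
      cases b
      · have : (mk [(a, false)]) = (of a)⁻¹ := mk_invLetter (a, true)
        simp only [transport_letter, edgeOf, Bool.false_eq_true, if_false]
        rw [show step (step v (a, false)) (a, true) = v from step_step_invLetter v (a, false), this]
        group
      · simp only [transport_letter, edgeOf, if_true]
        rfl
    rw [transport_cons, ih, hx, mk_cons_inv_smul, mk_cons x l]
    group

theorem loop_smul {o : X} {k : X → FreeGroup α} (hk : ∀ u, (k u)⁻¹ • o = u) (u : X) (a : α) :
    (k u * of a * (k (step u (a, true)))⁻¹) • o = o := by
  rw [mul_smul, hk, step_true, mul_smul, smul_inv_smul, ← eq_inv_smul_iff, hk]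

theorem transport_loop {o : X} {k : X → FreeGroup α} (hk : ∀ u, (k u)⁻¹ • o = u)
    (f : X × α → P) (u : X) (a : α) :
    transport f (k u * of a * (k (step u (a, true)))⁻¹) o
      = transport f (k u) o * f (u, a) * (transport f (k (step u (a, true))) o)⁻¹ := by
  have h := transport_inv f (k (step u (a, true))) o
  rw [hk] at h
  rw [transport_mul, transport_mul, mul_inv_rev, mul_smul, hk, transport_of, ← step_true, h]

theorem smul_coe_one_eq_iff {G : Type*} [Group G] {H : Subgroup G} {h : G} :
    h • ((1 : G) : G ⧸ H) = ((1 : G) : G ⧸ H) ↔ h ∈ H := by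
  rw [← MulAction.mem_stabilizer_iff, MulAction.stabilizer_quotient]

/-- A cocycle restricts to a homomorphism on a subgroup fixing the vertex `v`. -/
def transportHom (f : X × α → P) (H : Subgroup (FreeGroup α)) (v : X)
    (hv : ∀ h ∈ H, h • v = v) : H →* P where
  toFun h := transport f h v
  map_one' := transport_one f v
  map_mul' g h := by
    have : (g : FreeGroup α)⁻¹ • v = v := hv _ (H.inv_mem g.2)
    rw [Subgroup.coe_mul, transport_mul, this]

end Cocycles

/-! ### A loop crossing an edge exactly once is primitive -/

section Primitive

/-- If the path `p x q` from `v` to `v` crosses the edge of `x` only once, then deleting that edge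
leaves every vertex of the orbit of `v` within reach. -/
theorem exists_path_avoiding {α X : Type*} [MulAction (FreeGroup α) X] {v : X}
    {p q : List (α × Bool)} {x : α × Bool} (hv : (mk (p ++ x :: q))⁻¹ • v = v)
    (hp : edgeOf ((mk p)⁻¹ • v) x ∉ edges v p)
    (hq : edgeOf ((mk p)⁻¹ • v) x ∉ edges (step ((mk p)⁻¹ • v) x) q) (g : FreeGroup α) :
    ∃ l, edgeOf ((mk p)⁻¹ • v) x ∉ edges v l ∧ (mk l)⁻¹ • v = g⁻¹ • v := by
  obtain ⟨l, rfl⟩ : ∃ l, mk l = g := Quot.exists_rep g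
  set s := (mk p)⁻¹ • v with hs
  have hend : (mk q)⁻¹ • step s x = v := by
    rw [← mul_mk, mul_inv_rev, mul_smul, mk_cons_inv_smul] at hv
    exact hv
  have hfar : edgeOf s x ∉ edges v (invRev q) ∧ (mk (invRev q))⁻¹ • v = step s x := by
    constructor
    · have := edges_invRev (step s x) q
      rw [hend] at this
      rw [this]
      simpa using hq
    · rw [← inv_mk, inv_inv, ← hend, smul_inv_smul]
  induction l using List.reverseRecOn with
  | nil => exact ⟨[], by simp [edges], rfl⟩
  | append_singleton l y ih =>
    obtain ⟨m, hm, hml⟩ := ih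
    have hstep : (mk (l ++ [y]))⁻¹ • v = step ((mk l)⁻¹ • v) y := by
      rw [← mul_mk, mul_inv_rev, mul_smul, step]
    by_cases he : edgeOf ((mk l)⁻¹ • v) y = edgeOf s x
    · rcases eq_or_of_edgeOf_eq he with ⟨h1, rfl⟩ | ⟨h1, rfl⟩
      · exact ⟨invRev q, hfar.1, by rw [hstep, h1, hfar.2]⟩
      · exact ⟨p, hp, by rw [hstep, ← h1]⟩
    · refine ⟨m ++ [y], ?_, ?_⟩
      · rw [edges_append, hml]
        simp only [edges, List.mem_append, List.mem_singleton, not_or]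
        exact ⟨hm, Ne.symm he⟩
      · rw [hstep, ← hml, ← mul_mk, mul_inv_rev, mul_smul, step]

/-- If a loop `w` at the base vertex of the Schreier graph of `H` crosses some edge `e` exactly
once, then `w` is primitive in `H`: the loops avoiding `e` form a free group, and a basis of it
together with `w` is a basis of `H`. The inverse of the map from the free group on this set to `H`
is a cocycle. -/
theorem isPrimitive_of_edge_crossed_once {α : Type} {H : Subgroup (FreeGroup α)}
    {p q : List (α × Bool)} {x : α × Bool} (hw : mk (p ++ x :: q) ∈ H)
    (hp : edgeOf ((mk p)⁻¹ • ((1 : FreeGroup α) : FreeGroup α ⧸ H)) x ∉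
      edges ((1 : FreeGroup α) : FreeGroup α ⧸ H) p)
    (hq : edgeOf ((mk p)⁻¹ • ((1 : FreeGroup α) : FreeGroup α ⧸ H)) x ∉
      edges (step ((mk p)⁻¹ • ((1 : FreeGroup α) : FreeGroup α ⧸ H)) x) q) :
    IsPrimitive (⟨mk (p ++ x :: q), hw⟩ : H) := by
  classical
  set o : FreeGroup α ⧸ H := ((1 : FreeGroup α) : FreeGroup α ⧸ H) with ho
  have hfix : ∀ h : FreeGroup α, h • o = o ↔ h ∈ H :=
    fun _ => smul_coe_one_eq_iff
  set s := (mk p)⁻¹ • o with hs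
  set w := mk (p ++ x :: q) with hw_def
  have hwo : w⁻¹ • o = o := (hfix _).2 (H.inv_mem hw)
  -- paths `Q u` from the base vertex to `u` that avoid the edge
  have hQ : ∀ u : FreeGroup α ⧸ H, ∃ l, (edgeOf s x ∉ edges o l ∧ (mk l)⁻¹ • o = u) ∧
      (u = o → l = []) := by
    intro u
    by_cases hu : u = o
    · exact ⟨[], ⟨by simp [edges], by rw [hu, ← one_eq_mk, inv_one, one_smul]⟩, fun _ => rfl⟩
    · obtain ⟨g, rfl⟩ := QuotientGroup.mk_surjective u
      obtain ⟨l, h1, h2⟩ := exists_path_avoiding hwo hp hq g⁻¹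
      refine ⟨l, ⟨h1, ?_⟩, fun h => absurd h hu⟩
      rw [h2, inv_inv, ho, MulAction.Quotient.smul_coe, smul_eq_mul, mul_one]
  choose Q hQ hQo using hQ
  set k : FreeGroup α ⧸ H → FreeGroup α := fun u => mk (Q u) with hk
  have hko : k o = 1 := by simp [hk, hQo o rfl, ← one_eq_mk]
  have hku : ∀ u, (k u)⁻¹ • o = u := fun u => (hQ u).2
  -- the loop through an edge
  set F : (FreeGroup α ⧸ H) × α → FreeGroup α :=
    fun e => k e.1 * of e.2 * (k (step e.1 (e.2, true)))⁻¹ with hF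
  have hT : ∀ g v, transport F g v = k v * g * (k (g⁻¹ • v))⁻¹ := transport_coboundary k
  have hFH : ∀ e, F e ∈ H := by
    intro e
    rw [← hfix]
    exact loop_smul hku e.1 e.2
  set H0 : Subgroup (FreeGroup α) := Subgroup.closure (F '' {e | e ≠ edgeOf s x}) with hH0
  have hH0H : H0 ≤ H := by
    rw [hH0, Subgroup.closure_le]
    rintro _ ⟨e, -, rfl⟩
    exact hFH e
  have hF0 : ∀ e, e ≠ edgeOf s x → F e ∈ H0 := fun e he => Subgroup.subset_closure ⟨e, he, rfl⟩
  set b := IsFreeGroup.basis H0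
  set ι := IsFreeGroup.Generators H0
  let incl : H0 →* FreeGroup (Option ι) := (FreeGroup.map some).comp b.repr.toMonoidHom
  let F0 : (FreeGroup α ⧸ H) × α → H0 :=
    fun e => if he : e ≠ edgeOf s x then ⟨F e, hF0 e he⟩ else 1
  have hF0F : ∀ e, e ≠ edgeOf s x → H0.subtype (F0 e) = F e := by
    intro e he; simp [F0, he]
  have hF0T : ∀ l v, edgeOf s x ∉ edges v l →
      H0.subtype (transport F0 (mk l) v) = k v * mk l * (k ((mk l)⁻¹ • v))⁻¹ := by
    intro l v hl
    rw [map_transport, ← hT]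
    exact transport_congr fun e he => hF0F e fun h => hl (h ▸ he)
  -- the value `z` of the crossing is chosen so that `w` is sent to the basis element `none`
  let A := incl (transport F0 (mk p) o)
  let B := incl (transport F0 (mk q) (step s x))
  let z : FreeGroup (Option ι) := A⁻¹ * of none * B⁻¹
  let f : (FreeGroup α ⧸ H) × α → FreeGroup (Option ι) :=
    fun e => if e ≠ edgeOf s x then incl (F0 e) else if x.2 then z else z⁻¹
  have hfT : ∀ l v, edgeOf s x ∉ edges v l →
      transport f (mk l) v = incl (transport F0 (mk l) v) := by
    intro l v hl
    rw [map_transport]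
    refine transport_congr fun e he => ?_
    have : e ≠ edgeOf s x := fun h => hl (h ▸ he)
    simp [f, this]
  have hfx : transport f (mk [x]) s = z := by
    rw [transport_letter]
    simp only [f, ne_eq, not_true_eq_false, if_false]
    split_ifs <;> simp
  have hsplit : ∀ {G : Type} [Group G] (f : (FreeGroup α ⧸ H) × α → G),
      transport f w o = transport f (mk p) o * transport f (mk [x]) s *
        transport f (mk q) (step s x) := by
    intro G _ f
    rw [hw_def, ← mul_mk, transport_mul, transport_cons, mul_assoc]
  have hfw : transport f w o = of none := by
    rw [hsplit, hfx, hfT p o hp, hfT q _ hq]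
    change A * (A⁻¹ * of none * B⁻¹) * B = of none
    group
  let Φ : FreeGroup (Option ι) →* H := lift fun i => i.elim ⟨w, hw⟩ fun j => ⟨b j, hH0H (b j).2⟩
  have hΦ : ∀ h : H0, (Φ (incl h) : FreeGroup α) = h := by
    have : (H.subtype.comp Φ).comp incl = H0.subtype := by
      refine b.ext_hom _ _ fun i => ?_
      simp [incl, Φ]
    exact fun h => DFunLike.congr_fun this h
  have hΦw : (Φ (of none) : FreeGroup α) = w := by simp [Φ]
  have hΦT : ∀ l v, edgeOf s x ∉ edges v l →
      (H.subtype.comp Φ) (transport f (mk l) v) = transport F (mk l) v := by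
    intro l v hl
    rw [hfT l v hl, hT, ← hF0T l v hl]
    exact hΦ _
  have hΦf : (H.subtype.comp Φ) ∘ f = F := by
    have hx : (H.subtype.comp Φ) (transport f (mk [x]) s) = transport F (mk [x]) s := by
      have h1 : (H.subtype.comp Φ) (transport f w o) = transport F w o := by
        rw [hfw, hT, hwo, hko]
        simpa using hΦw
      rw [hsplit, hsplit, _root_.map_mul, _root_.map_mul, hΦT p o hp, hΦT q _ hq] at h1
      exact mul_left_cancel (mul_right_cancel h1)
    funext e
    by_cases he : e = edgeOf s x
    · subst he
      rw [map_transport, transport_letter, transport_letter] at hx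
      split_ifs at hx with hb
      · exact hx
      · exact inv_injective hx
    · simp only [Function.comp, f, ne_eq, he, not_false_eq_true, if_true]
      rw [← hF0F e he]
      exact hΦ _
  let Ψ : H →* FreeGroup (Option ι) := transportHom f H o fun h hh => (hfix h).2 hh
  have hΨ : ∀ h : H, Ψ h = transport f h o := fun _ => rfl
  have hΦΨ : ∀ h, Φ (Ψ h) = h := by
    intro h
    apply Subtype.ext
    change (H.subtype.comp Φ) (transport f h o) = h
    rw [map_transport, hΦf, hT, (hfix _).2 (H.inv_mem h.2), hko]
    simp
  have hΨH0 : ∀ h (hh : h ∈ H0), Ψ ⟨h, hH0H hh⟩ = incl ⟨h, hh⟩ := by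
    have hk1 : ∀ u, transport f (k u) o = 1 := by
      intro u
      have h1 := hF0T (Q u) o (hQ u).1
      rw [(hQ u).2, hko] at h1
      change transport f (mk (Q u)) o = 1
      rw [hfT _ _ (hQ u).1]
      have h2 : transport F0 (mk (Q u)) o = 1 := by
        apply H0.subtype_injective
        rw [h1, _root_.map_one, one_mul]
        exact mul_inv_cancel _
      rw [h2, _root_.map_one]
    intro h hh
    refine Subgroup.closure_induction (p := fun h hh => Ψ ⟨h, hH0H hh⟩ = incl ⟨h, hh⟩)
      ?_ ?_ ?_ ?_ hh
    · rintro _ ⟨e, he, rfl⟩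
      rw [hΨ]
      have he' : e ≠ edgeOf s x := he
      have hfe : incl ⟨F e, hF0 e he⟩ = f e := by simp [f, F0, he']
      rw [hfe]
      exact (transport_loop hku f e.1 e.2).trans (by rw [hk1, hk1]; simp)
    · exact (_root_.map_one Ψ).trans (_root_.map_one incl).symm
    · intro a c ha hc iha ihc
      have h1 := _root_.map_mul Ψ ⟨a, hH0H ha⟩ ⟨c, hH0H hc⟩
      have h2 := _root_.map_mul incl ⟨a, ha⟩ ⟨c, hc⟩
      rw [iha, ihc, ← h2] at h1
      exact h1
    · intro a ha iha
      have h1 := _root_.map_inv Ψ ⟨a, hH0H ha⟩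
      have h2 := _root_.map_inv incl ⟨a, ha⟩
      rw [iha, ← h2] at h1
      exact h1
  have hΨΦ : Ψ.comp Φ = MonoidHom.id _ := by
    ext i
    cases i with
    | none =>
      have : Φ (of none) = ⟨w, hw⟩ := by simp [Φ]
      rw [MonoidHom.comp_apply, this, hΨ]
      exact hfw
    | some i =>
      have : Φ (of (some i)) = ⟨b i, hH0H (b i).2⟩ := by simp [Φ]
      rw [MonoidHom.comp_apply, this, hΨH0 _ (b i).2]
      simp [incl]
  refine ⟨Option ι, .ofRepr
    { toFun := Ψ
      invFun := Φ
      left_inv := hΦΨ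
      right_inv := fun g => DFunLike.congr_fun hΨΦ g
      map_mul' := _root_.map_mul Ψ }, none, ?_⟩
  exact Subtype.ext hΦw

end Primitive

/-! ### Ranks -/

section Rank

/-- A surjection between free groups does not increase the rank, as it embeds the homomorphisms to
`ℤ/2` on the target into those on the source. -/
theorem freeRank_le_of_surjective {G G' : Type} [Group G] [Group G'] [IsFreeGroup G]
    [IsFreeGroup G'] (ρ : G →* G') (hρ : Function.Surjective ρ) : freeRank G' ≤ freeRank G := by
  classical
  have b := IsFreeGroup.basis G
  have c := IsFreeGroup.basis G'
  rw [freeRank_eq b, freeRank_eq c]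
  set ι := IsFreeGroup.Generators G
  set κ := IsFreeGroup.Generators G'
  rcases finite_or_infinite ι with hι | hι
  swap
  · simp
  let M := Multiplicative (ZMod 2)
  let Θ : (κ → M) → (ι → M) := fun f i => c.lift f (ρ (b i))
  have hΘ : Function.Injective Θ := by
    intro f f' h
    apply c.lift.injective
    have h1 : (c.lift f).comp ρ = (c.lift f').comp ρ := b.ext_hom _ _ fun i => congrFun h i
    exact MonoidHom.ext fun g => by
      obtain ⟨g, rfl⟩ := hρ g
      exact DFunLike.congr_fun h1 g
  have hfin : Finite (κ → M) := Finite.of_injective Θ hΘ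
  have hκ : Finite κ := by
    refine Finite.of_injective (fun k : κ => (fun l => if l = k then .ofAdd 1 else 1 : κ → M)) ?_
    intro k l h
    by_contra hne
    have := congrFun h k
    simp only [if_true, hne, if_false] at this
    exact absurd this (by decide)
  have := Fintype.ofFinite ι
  have := Fintype.ofFinite κ
  have hcard := Fintype.card_le_of_injective Θ hΘ
  have hM : Fintype.card M = 2 := by simp [M, Fintype.card_multiplicative, ZMod.card]
  rw [Fintype.card_fun, Fintype.card_fun, hM, Nat.pow_le_pow_iff_right (by norm_num)] at hcard
  simpa using hcard

/-- A finite subgraph of the Schreier graph of `H` satisfies `E - V + 1 ≤ rank H`: a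
`ℤ/2`-valued function on its edges is determined by the homomorphism that it induces on `H` and
by its sums along paths from the base vertex to the other vertices. -/
theorem card_edges_add_one_le {α : Type} {H : Subgroup (FreeGroup α)} {r : ℕ}
    (hr : freeRank H ≤ r) (S : Finset ((FreeGroup α ⧸ H) × α)) (V : Finset (FreeGroup α ⧸ H))
    (hS : ∀ e ∈ S, e.1 ∈ V ∧ step e.1 (e.2, true) ∈ V)
    (ho : ((1 : FreeGroup α) : FreeGroup α ⧸ H) ∈ V) : S.card + 1 ≤ V.card + r := by
  classical
  set o : FreeGroup α ⧸ H := ((1 : FreeGroup α) : FreeGroup α ⧸ H) with ho_def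
  have hfix : ∀ h : FreeGroup α, h • o = o ↔ h ∈ H :=
    fun _ => smul_coe_one_eq_iff
  have hk : ∀ u : FreeGroup α ⧸ H, ∃ g : FreeGroup α, g⁻¹ • o = u ∧ (u = o → g = 1) := by
    intro u
    by_cases hu : u = o
    · exact ⟨1, by simp [hu], fun _ => rfl⟩
    · obtain ⟨g, rfl⟩ := QuotientGroup.mk_surjective u
      exact ⟨g⁻¹, by rw [inv_inv, ho_def, MulAction.Quotient.smul_coe, smul_eq_mul, mul_one],
        fun h => absurd h hu⟩
  choose k hk hko using hk
  have b := IsFreeGroup.basis H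
  rw [freeRank_eq b] at hr
  set ι := IsFreeGroup.Generators H
  have : Finite ι := by
    by_contra h
    rw [not_finite_iff_infinite] at h
    simp at hr
  have := Fintype.ofFinite ι
  have hιr : Fintype.card ι ≤ r := by simpa using hr
  let M := Multiplicative (ZMod 2)
  let ext : (S → M) → (FreeGroup α ⧸ H) × α → M := fun f e => if he : e ∈ S then f ⟨e, he⟩ else 1
  let ρ : (S → M) → H →* M := fun f => transportHom (ext f) H o fun h hh => (hfix h).2 hh
  let Θ : (S → M) → (ι → M) × (V.erase o → M) :=
    fun f => (fun i => ρ f (b i), fun v => transport (ext f) (k v) o)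
  have hΘ : Function.Injective Θ := by
    intro f f' h
    have h1 : ρ f = ρ f' := b.ext_hom _ _ fun i => congrFun (congrArg Prod.fst h) i
    have h2 : ∀ v ∈ V, transport (ext f) (k v) o = transport (ext f') (k v) o := by
      intro v hv
      by_cases hvo : v = o
      · rw [hko v hvo, transport_one, transport_one]
      · exact congrFun (congrArg Prod.snd h) ⟨v, Finset.mem_erase.2 ⟨hvo, hv⟩⟩
    funext ⟨⟨u, a⟩, he⟩
    have h3 := DFunLike.congr_fun h1 ⟨_, (hfix _).1 (loop_smul hk u a)⟩
    have h4 : transport (ext f) (k u * of a * (k (step u (a, true)))⁻¹) o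
        = transport (ext f') (k u * of a * (k (step u (a, true)))⁻¹) o := h3
    rw [transport_loop hk, transport_loop hk, h2 _ (hS _ he).1, h2 _ (hS _ he).2] at h4
    have h5 := mul_left_cancel (mul_right_cancel h4)
    simpa [ext, he] using h5
  have hcard := Fintype.card_le_of_injective Θ hΘ
  have hM : Fintype.card M = 2 := by simp [M, Fintype.card_multiplicative, ZMod.card]
  rw [Fintype.card_prod, Fintype.card_fun, Fintype.card_fun, Fintype.card_fun, hM, ← pow_add,
    Nat.pow_le_pow_iff_right (by norm_num), Fintype.card_coe, Fintype.card_coe,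
    Finset.card_erase_of_mem ho] at hcard
  have := Finset.card_pos.2 ⟨o, ho⟩
  omega

end Rank

open CategoryTheory

/-! ### Finite subgraphs of Schreier graphs as `A`-graphs -/

section Subgraph

/-- Induction over the morphisms of a free groupoid. -/
theorem freeGroupoid_induction {V : Type*} [Quiver V]
    {motive : ∀ u v : V,
      ((Quiver.FreeGroupoid.of V).obj u ⟶ (Quiver.FreeGroupoid.of V).obj v) → Prop}
    (id : ∀ u, motive u u (𝟙 _))
    (of : ∀ u v (e : u ⟶ v), motive u v ((Quiver.FreeGroupoid.of V).map e))
    (inv : ∀ u v p, motive u v p → motive v u (Groupoid.inv p))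
    (comp : ∀ u v w p q, motive u v p → motive v w q → motive u w (p ≫ q))
    {u v : V} (p : (Quiver.FreeGroupoid.of V).obj u ⟶ (Quiver.FreeGroupoid.of V).obj v) :
    motive u v p := by
  obtain ⟨p, rfl⟩ := Quot.exists_rep p
  change Quiver.Path (V := Quiver.Symmetrify V) u v at p
  induction p with
  | nil => exact id u
  | @cons v w p e ih =>
    rcases e with e | e
    · exact comp _ _ _ _ _ ih (of _ _ e)
    · exact comp _ _ _ _ _ ih (inv _ _ _ (of _ _ e))

variable {α X : Type} [MulAction (FreeGroup α) X]

/-- The subgraph of the Schreier graph formed by a set `S` of edges and their end points. -/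
def subgraph (S : Set (X × α)) : AGraph α where
  V := {v : X // ∃ x, edgeOf v x ∈ S}
  quiver := ⟨fun u v => {a : α // (u.1, a) ∈ S ∧ step u.1 (a, true) = v.1}⟩
  posLabel e := e.1

variable {S : Set (X × α)}

theorem edgeOf_label {u v : (subgraph S).Vertex} (e : u ⟶ v) :
    edgeOf u.1 ((subgraph S).label e) ∈ S ∧ step u.1 ((subgraph S).label e) = v.1 := by
  rcases e with ⟨a, h1, h2⟩ | ⟨a, h1, h2⟩
  · exact ⟨h1, h2⟩
  · have h3 : step u.1 (a, false) = v.1 := by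
      rw [← h2]
      exact step_step_invLetter v.1 (a, true)
    refine ⟨?_, h3⟩
    change (step u.1 (a, false), a) ∈ S
    rw [h3]
    exact h1

theorem exists_arrow {u : (subgraph S).Vertex} {x : α × Bool} (h : edgeOf u.1 x ∈ S) :
    ∃ (v : (subgraph S).Vertex) (e : u ⟶ v), v.1 = step u.1 x ∧ (subgraph S).label e = x := by
  refine ⟨⟨step u.1 x, invLetter x, by rwa [edgeOf_step_invLetter]⟩, ?_⟩
  obtain ⟨a, b⟩ := x
  cases b
  · exact ⟨.inr ⟨a, h, step_step_invLetter u.1 (a, false)⟩, rfl, rfl⟩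
  · exact ⟨.inl ⟨a, h, rfl⟩, rfl, rfl⟩

theorem folded_subgraph : (subgraph S).Folded := by
  rintro u ⟨v, e⟩ ⟨v', e'⟩ h
  have h' : (subgraph S).label e = (subgraph S).label e' := h
  have hv : v = v' := Subtype.ext (by rw [← (edgeOf_label e).2, ← (edgeOf_label e').2, h'])
  subst hv
  congr 1
  obtain ⟨h3, h4⟩ := Prod.ext_iff.1 h'
  rcases e with ⟨a, h1⟩ | ⟨a, h1⟩ <;> rcases e' with ⟨a', h2⟩ | ⟨a', h2⟩
  · obtain rfl : a = a' := h3
    rfl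
  · exact absurd (show true = false from h4) (by simp)
  · exact absurd (show false = true from h4) (by simp)
  · obtain rfl : a = a' := h3
    rfl

theorem numEdges_subgraph : (subgraph S).numEdges = ENat.card S := by
  refine ENat.card_congr
    { toFun := fun e => ⟨(e.left.1, e.hom.1), e.hom.2.1⟩
      invFun := fun e => ⟨⟨e.1.1, (e.1.2, true), e.2⟩,
        ⟨step e.1.1 (e.1.2, true), invLetter (e.1.2, true), by
          rw [edgeOf_step_invLetter]; exact e.2⟩, ⟨e.1.2, e.2, rfl⟩⟩
      left_inv := ?_
      right_inv := fun e => rfl }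
  rintro ⟨⟨u, hu⟩, ⟨v, hv⟩, ⟨a, h1, h2⟩⟩
  simp only at h2
  subst h2
  rfl

theorem degree_subgraph_lt [Fintype α] {u : (subgraph S).Vertex} {x : α × Bool}
    (h : edgeOf u.1 x ∉ S) :
    (subgraph S).degree u < ((2 * Fintype.card α : ℕ) : ℕ∞) := by
  classical
  let F : Quiver.Star u → {y : α × Bool // y ≠ x} := fun e => ⟨(subgraph S).label e.2, fun he =>
    h (he ▸ (edgeOf_label e.2).1)⟩
  have hF : Function.Injective F := fun e e' hee =>
    folded_subgraph u (congrArg Subtype.val hee)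
  refine (ENat.card_le_card_of_injective hF).trans_lt ?_
  rw [ENat.card_eq_coe_fintype_card, Nat.cast_lt, Fintype.card_subtype_compl]
  have : 0 < Fintype.card (α × Bool) := Fintype.card_pos_iff.2 ⟨x⟩
  simp only [Fintype.card_prod, Fintype.card_bool, Fintype.card_subtype_eq] at this ⊢
  omega

theorem exists_edgePath (u : (subgraph S).Vertex) (l : List (α × Bool))
    (h : ∀ e ∈ edges u.1 l, e ∈ S) :
    ∃ (v : (subgraph S).Vertex) (p : (subgraph S).EdgePath u v),
      v.1 = (mk l)⁻¹ • u.1 ∧ (subgraph S).pathLabel p = l := by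
  induction l using List.reverseRecOn with
  | nil => exact ⟨u, .nil, by simp [← one_eq_mk], rfl⟩
  | append_singleton l x ih =>
    rw [edges_append] at h
    obtain ⟨v, p, hv, hp⟩ := ih fun e he => h e (List.mem_append_left _ he)
    have hx : edgeOf v.1 x ∈ S := h _ (List.mem_append_right _ (by simp [edges, hv]))
    obtain ⟨v', e, hv', he⟩ := exists_arrow hx
    refine ⟨v', p.cons e, ?_, ?_⟩
    · rw [hv', hv, ← mul_mk, mul_inv_rev, mul_smul, step]
    · simp [AGraph.pathLabel, hp, he]

/-- The label of a morphism of the fundamental groupoid, with the sign chosen so that a morphism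
`p` from `v` to `w` satisfies `w = pathAction p • v`: it is the inverse of the word read along
`p`. -/
noncomputable def pathAction {v w : (subgraph S).V}
    (p : (Quiver.FreeGroupoid.of _).obj v ⟶ (Quiver.FreeGroupoid.of _).obj w) : FreeGroup α :=
  (Quiver.FreeGroupoid.lift
    { obj := fun _ => SingleObj.star (FreeGroup α)
      map := fun e => ((of e.1)⁻¹ : FreeGroup α) } :
    Quiver.FreeGroupoid (subgraph S).V ⥤ SingleObj (FreeGroup α)).map p

theorem pathAction_of {v w : (subgraph S).V} (e : v ⟶ w) :
    pathAction ((Quiver.FreeGroupoid.of _).map e) = (of e.1)⁻¹ := by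
  have h : ((of e.1)⁻¹ : FreeGroup α) * 1 = (of e.1)⁻¹ := mul_one _
  exact h

theorem pathAction_id (v : (subgraph S).V) :
    pathAction (𝟙 ((Quiver.FreeGroupoid.of _).obj v)) = 1 :=
  rfl

theorem pathAction_comp {v w z : (subgraph S).V}
    (p : (Quiver.FreeGroupoid.of _).obj v ⟶ (Quiver.FreeGroupoid.of _).obj w)
    (q : (Quiver.FreeGroupoid.of _).obj w ⟶ (Quiver.FreeGroupoid.of _).obj z) :
    pathAction (p ≫ q) = pathAction q * pathAction p :=
  Functor.map_comp _ p q

theorem pathAction_inv {v w : (subgraph S).V}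
    (p : (Quiver.FreeGroupoid.of _).obj v ⟶ (Quiver.FreeGroupoid.of _).obj w) :
    pathAction (Groupoid.inv p) = (pathAction p)⁻¹ := by
  rw [eq_inv_iff_mul_eq_one, ← pathAction_comp, Groupoid.comp_inv, pathAction_id]

/-- The homomorphism from the fundamental group to the free group given by `pathAction`. -/
noncomputable def pathActionHom (S : Set (X × α)) (u : (subgraph S).V) :
    (subgraph S).fundamentalGroup u →* FreeGroup α where
  toFun p := pathAction p
  map_one' := pathAction_id _
  map_mul' p q := pathAction_comp q p

/-- The loop at `u` obtained from a morphism by means of the connecting morphisms `t`. -/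
def loop {u : (subgraph S).V}
    (t : ∀ v, (Quiver.FreeGroupoid.of _).obj u ⟶ (Quiver.FreeGroupoid.of _).obj v)
    {v w : (subgraph S).V}
    (p : (Quiver.FreeGroupoid.of _).obj v ⟶ (Quiver.FreeGroupoid.of _).obj w) :
    (subgraph S).fundamentalGroup u :=
  t v ≫ p ≫ Groupoid.inv (t w)

section

variable {u : (subgraph S).V}
  (t : ∀ v, (Quiver.FreeGroupoid.of _).obj u ⟶ (Quiver.FreeGroupoid.of _).obj v)

theorem loop_id (v : (subgraph S).V) : loop t (𝟙 ((Quiver.FreeGroupoid.of _).obj v)) = 1 := by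
  simp only [loop, Category.id_comp, Groupoid.comp_inv]
  rfl

theorem loop_comp {v w z : (subgraph S).V}
    (p : (Quiver.FreeGroupoid.of _).obj v ⟶ (Quiver.FreeGroupoid.of _).obj w)
    (q : (Quiver.FreeGroupoid.of _).obj w ⟶ (Quiver.FreeGroupoid.of _).obj z) :
    loop t (p ≫ q) = loop t q * loop t p := by
  simp [loop, End.mul_def]

theorem loop_inv {v w : (subgraph S).V}
    (p : (Quiver.FreeGroupoid.of _).obj v ⟶ (Quiver.FreeGroupoid.of _).obj w) :
    loop t (Groupoid.inv p) = (loop t p)⁻¹ := by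
  rw [eq_inv_iff_mul_eq_one, ← loop_comp, Groupoid.comp_inv, loop_id]

open Classical in
/-- The cocycle values on edges that retract the Schreier graph onto the subgraph: an edge of the
subgraph is sent to the inverse of its loop, the other edges to `1`. Multiplication in `End`
reverses the order of paths, and the inverse undoes this. -/
noncomputable def retraction (e : X × α) : (subgraph S).fundamentalGroup u :=
  if h : e ∈ S then
    (loop t (v := ⟨e.1, (e.2, true), h⟩)
      (w := ⟨step e.1 (e.2, true), invLetter (e.2, true), by rwa [edgeOf_step_invLetter]⟩)
      ((Quiver.FreeGroupoid.of _).map ⟨e.2, h, rfl⟩))⁻¹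
  else 1

theorem retraction_arrow {v w : (subgraph S).V} (e : v ⟶ w) :
    retraction t (v.1, e.1) = (loop t ((Quiver.FreeGroupoid.of _).map e))⁻¹ := by
  obtain ⟨v, hv⟩ := v
  obtain ⟨w, hw⟩ := w
  obtain ⟨a, h1, h2⟩ := e
  simp only at h1 h2
  subst h2
  exact dif_pos h1

/-- On paths of the subgraph, the cocycle `retraction` recovers the homotopy class of the path. -/
theorem transport_retraction {v w : (subgraph S).V}
    (p : (Quiver.FreeGroupoid.of _).obj v ⟶ (Quiver.FreeGroupoid.of _).obj w) :
    pathAction p • v.1 = w.1 ∧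
      transport (retraction t) (pathAction p)⁻¹ v.1 = (loop t p)⁻¹ := by
  induction p using freeGroupoid_induction with
  | id v =>
    rw [pathAction_id, inv_one, loop_id, inv_one, transport_one, one_smul]
    exact ⟨rfl, rfl⟩
  | of v w e =>
    rw [pathAction_of, inv_inv, transport_of, retraction_arrow]
    exact ⟨e.2.2, rfl⟩
  | inv v w p ih =>
    obtain ⟨h1, h2⟩ := ih
    have h4 := transport_inv (retraction t) (pathAction p)⁻¹ v.1
    rw [h2, inv_inv, inv_inv, h1] at h4
    rw [pathAction_inv, inv_inv, loop_inv, inv_inv, h4, inv_smul_eq_iff, h1]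
    exact ⟨rfl, rfl⟩
  | comp v w z p q ihp ihq =>
    rw [pathAction_comp, mul_smul, ihp.1, ihq.1, mul_inv_rev, transport_mul, inv_inv, ihp.1, ihp.2,
      ihq.2, loop_comp, mul_inv_rev]
    exact ⟨rfl, rfl⟩

end

/-- The fundamental group of a connected subgraph of the Schreier graph of `H` is a retract of `H`,
so that it is free of rank at most that of `H`. -/
theorem freeRank_fundamentalGroup_le {H : Subgroup (FreeGroup α)}
    {S : Set ((FreeGroup α ⧸ H) × α)} (hS : (subgraph S).Connected) (u : (subgraph S).Vertex)
    (hu : u.1 = ((1 : FreeGroup α) : FreeGroup α ⧸ H)) :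
    freeRank ((subgraph S).fundamentalGroup u) ≤ freeRank H := by
  have hfix : ∀ h : FreeGroup α, h • u.1 = u.1 ↔ h ∈ H := by
    rw [hu]
    exact fun _ => smul_coe_one_eq_iff
  let t : ∀ v : (subgraph S).V,
      (Quiver.FreeGroupoid.of (subgraph S).V).obj u ⟶ (Quiver.FreeGroupoid.of _).obj v :=
    fun v => Quot.mk _ (hS.2 u v).some
  let ρ : H →* (subgraph S).fundamentalGroup u :=
    transportHom (retraction t) H u.1 fun h hh => (hfix h).2 hh
  have hinj : Function.Injective (pathActionHom S u) := by
    rw [injective_iff_map_eq_one]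
    intro p hp
    have h1 := (transport_retraction t (v := u) (w := u) p).2
    have h2 : pathAction (v := u) (w := u) p = 1 := hp
    rw [h2, inv_one, transport_one, eq_comm, inv_eq_one] at h1
    have h3 : t u ≫ p ≫ Groupoid.inv (t u) = 𝟙 _ := h1
    have h4 : p = Groupoid.inv (t u) ≫ (t u ≫ p ≫ Groupoid.inv (t u)) ≫ t u := by simp
    rw [h4, h3]
    simp
  have hfree : IsFreeGroup ((subgraph S).fundamentalGroup u) :=
    IsFreeGroup.ofMulEquiv (MonoidHom.ofInjective hinj).symm
  refine freeRank_le_of_surjective ρ fun p => ?_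
  let p' : (subgraph S).fundamentalGroup u :=
    Groupoid.inv (t u) ≫ (p : (Quiver.FreeGroupoid.of (subgraph S).V).obj u ⟶ _) ≫ t u
  obtain ⟨h1, h2⟩ := transport_retraction t (v := u) (w := u) p'
  let h : H := ⟨(pathAction (v := u) (w := u) p')⁻¹, H.inv_mem ((hfix _).1 h1)⟩
  have h3 : ρ h = (loop t p')⁻¹ := h2
  refine ⟨h⁻¹, ?_⟩
  rw [_root_.map_inv, h3, inv_inv]
  simp [loop, p']

end Subgraph

/-! ### Cyclic words -/

section CyclicWords

variable {α : Type*}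

theorem isReduced_append_self {L : List (α × Bool)} (h : IsCyclicallyReduced L) :
    IsReduced (L ++ L) := by
  rcases L.eq_nil_or_concat with rfl | ⟨l, z, rfl⟩
  · simp
  · exact List.isChain_append.2 ⟨h.1, h.1, h.2⟩

theorem isCyclicallyReduced_of_append_self {L : List (α × Bool)} (h : IsReduced (L ++ L)) :
    IsCyclicallyReduced L :=
  ⟨(List.isChain_append.1 h).1, (List.isChain_append.1 h).2.2⟩

theorem isCyclicallyReduced_append_comm {p s : List (α × Bool)}
    (h : IsCyclicallyReduced (p ++ s)) : IsCyclicallyReduced (s ++ p) := by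
  apply isCyclicallyReduced_of_append_self
  have h3 := (h.flatten_replicate 3).isReduced
  exact h3.infix ⟨p, s, by simp [List.replicate]⟩

theorem isCyclicallyReduced_invRev {L : List (α × Bool)} (h : IsCyclicallyReduced L) :
    IsCyclicallyReduced (invRev L) := by
  apply isCyclicallyReduced_of_append_self
  rw [← invRev_append]
  exact isReduced_invRev (isReduced_append_self h)

/-- Commuting words are powers of a common element. -/
theorem exists_pow_of_append_comm (N : ℕ) : ∀ x y : List (α × Bool), x.length + y.length ≤ N →
    x ++ y = y ++ x → ∃ (z : FreeGroup α) (m n : ℕ), mk x = z ^ m ∧ mk y = z ^ n ∧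
      (x ≠ [] → m ≠ 0) ∧ (y ≠ [] → n ≠ 0) := by
  induction N with
  | zero =>
    intro x y hN _
    have hx : x = [] := List.length_eq_zero_iff.1 (by omega)
    have hy : y = [] := List.length_eq_zero_iff.1 (by omega)
    exact ⟨1, 0, 0, by simp [hx, ← one_eq_mk], by simp [hy, ← one_eq_mk], fun h => absurd hx h,
      fun h => absurd hy h⟩
  | succ N ih =>
    have key : ∀ x y : List (α × Bool), x.length ≤ y.length → x.length + y.length ≤ N + 1 →
        x ++ y = y ++ x → ∃ (z : FreeGroup α) (m n : ℕ), mk x = z ^ m ∧ mk y = z ^ n ∧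
          (x ≠ [] → m ≠ 0) ∧ (y ≠ [] → n ≠ 0) := by
      intro x y hxy hN h
      by_cases hx : x = []
      · subst hx
        exact ⟨mk y, 0, 1, by simp [← one_eq_mk], by simp, fun h => absurd rfl h, by simp⟩
      obtain ⟨t, rfl⟩ : x <+: y :=
        List.prefix_of_prefix_length_le ⟨y, h⟩ ⟨x, rfl⟩ hxy
      have hlx : 0 < x.length := List.length_pos_iff.2 hx
      rw [List.append_assoc, List.append_cancel_left_eq] at h
      simp only [List.length_append] at hN
      obtain ⟨z, m, n, h1, h2, h3, -⟩ := ih x t (by omega) h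
      exact ⟨z, m, m + n, h1, by rw [← mul_mk, h1, h2, pow_add], h3, fun _ => by
        have := h3 hx; omega⟩
    intro x y hN h
    rcases le_total x.length y.length with hl | hl
    · exact key x y hl hN h
    · obtain ⟨z, m, n, h1, h2, h3, h4⟩ := key y x hl (by omega) h.symm
      exact ⟨z, n, m, h2, h1, h4, h3⟩

/-- A word with two equal cyclic permutations is a proper power. -/
theorem isProperPower_of_rotation_eq {p s p' s' : List (α × Bool)} (h : p ++ s = p' ++ s')
    (hrot : s ++ p = s' ++ p') (hp : p.length < p'.length) (hs : s' ≠ []) :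
    IsProperPower (mk (p ++ s)) := by
  obtain ⟨t, rfl⟩ : p <+: p' := List.prefix_of_prefix_length_le ⟨s, h⟩ ⟨s', rfl⟩ hp.le
  rw [List.append_assoc, List.append_cancel_left_eq] at h
  subst h
  have ht : t ≠ [] := by rintro rfl; simp at hp
  obtain ⟨z, m, n, h1, h2, h3, h4⟩ := exists_pow_of_append_comm _ t (s' ++ p) le_rfl
    (by simpa using hrot)
  have hm := h3 ht
  have hn := h4 (by simp [hs])
  refine ⟨mk p * z * (mk p)⁻¹, m + n, by omega, ?_⟩
  rw [conj_pow, pow_add, ← h1, ← h2]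
  simp only [← mul_mk]
  group

/-- A nontrivial reduced word is not a cyclic permutation of its inverse. -/
theorem not_isRotated_invRev {L : List (α × Bool)} (h : IsReduced L) (hL : L ≠ []) :
    ¬ L ~r invRev L := by
  classical
  have key : ∀ a : List (α × Bool), IsReduced a → invRev a = a → a = [] := by
    intro a ha h
    have h1 : (mk a)⁻¹ = mk a := by rw [inv_mk, h]
    have h2 : mk a ^ 2 = 1 ^ 2 := by
      rw [pow_two, one_pow]
      nth_rewrite 1 [← h1]
      exact inv_mul_cancel _
    have h3 : mk a = 1 := pow_left_injective two_ne_zero h2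
    rw [← toWord_eq_nil_iff, toWord_mk, ha.reduce_eq] at h3
    exact h3
  rintro ⟨n, hn⟩
  rw [← List.rotate_mod,
    List.rotate_eq_drop_append_take (Nat.mod_lt _ (List.length_pos_iff.2 hL)).le] at hn
  set k := n % L.length
  have hk : L.take k ++ L.drop k = L := List.take_append_drop k L
  have h1 : invRev (L.drop k) ++ invRev (L.take k) = L.drop k ++ L.take k := by
    rw [← invRev_append, hk, hn]
  obtain ⟨h2, h3⟩ := List.append_inj h1 (by simp)
  have h4 := key _ (h.infix (List.drop_suffix k L).isInfix) h2
  have h5 := key _ (h.infix (List.take_prefix k L).isInfix) h3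
  rw [h4, h5] at hk
  exact hL hk.symm

end CyclicWords

/-! ### Following arcs in a subgraph of the Schreier graph -/

section Arcs

variable {α X : Type*} [MulAction (FreeGroup α) X] [DecidableEq X]

/-- The vertices of the subgraph `S`. -/
def vertices (S : Finset (X × α)) : Finset X :=
  S.image Prod.fst ∪ S.image fun e => step e.1 (e.2, true)

theorem mem_vertices {S : Finset (X × α)} {v : X} : v ∈ vertices S ↔ ∃ x, edgeOf v x ∈ S := by
  simp only [vertices, Finset.mem_union, Finset.mem_image, Prod.exists, exists_and_right,
    exists_eq_right]
  constructor
  · rintro (⟨a, h⟩ | ⟨u, a, h, rfl⟩)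
    · exact ⟨a, true, h⟩
    · exact ⟨a, false, (edgeOf_step_invLetter u (a, true)).symm ▸ h⟩
  · rintro ⟨a, b, h⟩
    cases b
    · exact .inr ⟨_, a, h, step_step_invLetter v (a, false)⟩
    · exact .inl ⟨a, h⟩

variable [Fintype α] [DecidableEq α]

/-- The letters labelling the oriented edges of the subgraph `S` that issue from `v`. -/
def outLetters (S : Finset (X × α)) (v : X) : Finset (α × Bool) := {x | edgeOf v x ∈ S}

@[simp] theorem mem_outLetters {S : Finset (X × α)} {v : X} {x : α × Bool} :
    x ∈ outLetters S v ↔ edgeOf v x ∈ S := by simp [outLetters]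

/-- `Follow S k d d'` says that the reduced path of `k` steps that starts with the oriented edge `d`
and ends with the oriented edge `d'` passes through vertices of degree at most two only. -/
inductive Follow (S : Finset (X × α)) : ℕ → X × (α × Bool) → X × (α × Bool) → Prop
  | zero (d) : Follow S 0 d d
  | succ {k v x y d} : edgeOf v x ∈ S → edgeOf (step v x) y ∈ S → y ≠ invLetter x →
      (outLetters S (step v x)).card < 3 → Follow S k (step v x, y) d → Follow S (k + 1) (v, x) d

theorem eq_of_card_lt_three {β : Type*} [DecidableEq β] {s : Finset β} (hs : s.card < 3)
    {a b c : β} (ha : a ∈ s) (hb : b ∈ s) (hc : c ∈ s) (hac : a ≠ c) (hbc : b ≠ c) : a = b := by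
  by_contra hab
  have h : ({a, b, c} : Finset β) ⊆ s := by
    intro z hz
    simp only [Finset.mem_insert, Finset.mem_singleton] at hz
    rcases hz with rfl | rfl | rfl <;> assumption
  have := Finset.card_le_card h
  rw [Finset.card_eq_three.2 ⟨a, b, c, hab, hac, hbc, rfl⟩] at this
  omega

/-- Following an arc is reversible. -/
theorem Follow.injective {S : Finset (X × α)} {k : ℕ} {d₁ d₂ d : X × (α × Bool)}
    (h₁ : Follow S k d₁ d) (h₂ : Follow S k d₂ d) : d₁ = d₂ := by
  induction k generalizing d₁ d₂ with
  | zero => cases h₁; cases h₂; rfl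
  | succ k ih =>
    cases h₁ with
    | @succ _ v₁ x₁ y₁ _ a₁ b₁ c₁ e₁ f₁ =>
    cases h₂ with
    | @succ _ v₂ x₂ y₂ _ a₂ b₂ c₂ e₂ f₂ =>
    have h := ih f₁ f₂
    simp only [Prod.mk.injEq] at h
    obtain ⟨hv, rfl⟩ := h
    have hx : invLetter x₁ = invLetter x₂ := by
      refine eq_of_card_lt_three e₁ ?_ ?_ (mem_outLetters.2 b₁) c₁.symm c₂.symm
      · rwa [mem_outLetters, edgeOf_step_invLetter]
      · rwa [mem_outLetters, hv, edgeOf_step_invLetter]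
    have hx' : x₁ = x₂ := by rw [← invLetter_invLetter x₁, hx, invLetter_invLetter]
    subst hx'
    rw [← step_step_invLetter v₁ x₁, hv, step_step_invLetter]

/-- Two distinct reduced words read in `S` from the same vertex with the same first letter diverge
at a branch vertex; before that they run along a common arc. -/
theorem exists_follow_of_ne {S : Finset (X × α)} {l l' : List (α × Bool)} {v : X} {x : α × Bool}
    (hr : IsReduced (x :: l)) (hr' : IsReduced (x :: l')) (hlen : l.length = l'.length)
    (hne : l ≠ l') (hS : ∀ e ∈ edges v (x :: l), e ∈ S) (hS' : ∀ e ∈ edges v (x :: l'), e ∈ S) :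
    ∃ (k : ℕ) (d : X × (α × Bool)) (c : List (α × Bool)), Follow S k (v, x) d ∧
      edgeOf d.1 d.2 ∈ S ∧ 3 ≤ (outLetters S (step d.1 d.2)).card ∧ c.length = k + 1 ∧
      c <+: x :: l ∧ c <+: x :: l' := by
  induction l generalizing v x l' with
  | nil => exact absurd (List.length_eq_zero_iff.1 hlen.symm).symm hne
  | cons y m ih =>
    cases l' with
    | nil => simp at hlen
    | cons y' m' =>
    have hx : edgeOf v x ∈ S := hS _ (by simp [edges])
    by_cases hb : 3 ≤ (outLetters S (step v x)).card
    · exact ⟨0, (v, x), [x], .zero _, hx, hb, rfl, ⟨_, rfl⟩, ⟨_, rfl⟩⟩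
    have hy : edgeOf (step v x) y ∈ S := hS _ (by simp [edges])
    have hy' : edgeOf (step v x) y' ∈ S := hS' _ (by simp [edges])
    have hyx : y ≠ invLetter x := isReduced_pair_iff.1 (hr.infix ⟨[], m, rfl⟩)
    have hyx' : y' ≠ invLetter x := isReduced_pair_iff.1 (hr'.infix ⟨[], m', rfl⟩)
    have hxout : invLetter x ∈ outLetters S (step v x) := by
      rwa [mem_outLetters, edgeOf_step_invLetter]
    obtain rfl : y = y' := eq_of_card_lt_three (not_le.1 hb) (mem_outLetters.2 hy)
      (mem_outLetters.2 hy') hxout hyx hyx'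
    obtain ⟨k, d, c, h1, h2, h3, h4, ⟨u, h5⟩, ⟨u', h6⟩⟩ := ih (v := step v x)
      (hr.infix ⟨[x], [], by simp⟩) (hr'.infix ⟨[x], [], by simp⟩) (by simpa using hlen)
      (by simpa using hne) (fun e he => hS e (List.mem_cons_of_mem _ he))
      (fun e he => hS' e (List.mem_cons_of_mem _ he))
    exact ⟨k + 1, d, x :: c, .succ hx hy hyx (not_le.1 hb) h1, h2, h3, by simp [h4],
      ⟨u, by simp [h5]⟩, ⟨u', by simp [h6]⟩⟩

/-- The sum of the degrees of the vertices is twice the number of edges. -/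
theorem sum_card_outLetters (S : Finset (X × α)) :
    ∑ v ∈ vertices S, (outLetters S v).card = 2 * S.card := by
  rw [← Finset.card_sigma, mul_comm, ← Fintype.card_bool, ← Finset.card_univ (α := Bool),
    ← Finset.card_product]
  refine (Finset.card_bij
    (fun (p : (X × α) × Bool) _ => (⟨if p.2 then p.1.1 else step p.1.1 (p.1.2, true),
      (p.1.2, p.2)⟩ : Σ _ : X, α × Bool)) ?_ ?_ ?_).symm
  · rintro ⟨⟨u, a⟩, b⟩ h
    simp only [Finset.mem_product, Finset.mem_univ, and_true] at h
    have h' : edgeOf (if b then u else step u (a, true)) (a, b) ∈ S := by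
      cases b
      · exact (edgeOf_step_invLetter u (a, true)).symm ▸ h
      · exact h
    exact Finset.mem_sigma.2 ⟨mem_vertices.2 ⟨_, h'⟩, mem_outLetters.2 h'⟩
  · rintro ⟨⟨u, a⟩, b⟩ - ⟨⟨u', a'⟩, b'⟩ - h
    simp only [Sigma.mk.injEq, heq_eq_eq, Prod.mk.injEq] at h
    obtain ⟨h1, rfl, rfl⟩ := h
    cases b
    · simp only [Bool.false_eq_true, if_false] at h1
      rw [← step_step_invLetter u (a, true), h1, step_step_invLetter]
    · simp only [if_true] at h1
      rw [h1]
  · rintro ⟨v, a, b⟩ h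
    have h' := mem_outLetters.1 (Finset.mem_sigma.1 h).2
    refine ⟨(edgeOf v (a, b), b), Finset.mem_product.2 ⟨h', Finset.mem_univ _⟩, ?_⟩
    cases b
    · simp only [edgeOf, Bool.false_eq_true, if_false]
      rw [show step (step v (a, false)) (a, true) = v from step_step_invLetter v (a, false)]
    · rfl

/-- If all vertices have degree at least two and every arc issuing from any oriented edge reaches a
branch vertex in fewer than `K` steps, then the number of edges is bounded in terms of `K` and the
Euler characteristic; `B` is the number of oriented edges at branch vertices. -/
theorem exists_card_edges_le (S : Finset (X × α)) (K : ℕ)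
    (hdeg : ∀ v ∈ vertices S, 2 ≤ (outLetters S v).card)
    (hK : ∀ v x, edgeOf v x ∈ S → ∃ k < K, ∃ d, Follow S k (v, x) d ∧ edgeOf d.1 d.2 ∈ S ∧
      3 ≤ (outLetters S (step d.1 d.2)).card) :
    ∃ B, B + 6 * (vertices S).card ≤ 6 * S.card ∧ 2 * S.card ≤ B * K := by
  set V := vertices S
  set Vb := V.filter fun v => 3 ≤ (outLetters S v).card
  refine ⟨(Vb.sigma fun v => outLetters S v).card, ?_, ?_⟩
  · rw [Finset.card_sigma, Finset.sum_filter]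
    -- a branch vertex of degree `d` satisfies `d ≤ 3 (d - 2)`, and `d = 2` at other vertices
    have h : ∑ v ∈ V, ((if 3 ≤ (outLetters S v).card then (outLetters S v).card else 0) + 6)
        ≤ ∑ v ∈ V, 3 * (outLetters S v).card := by
      refine Finset.sum_le_sum fun v hv => ?_
      have := hdeg v hv
      split_ifs <;> omega
    rw [Finset.sum_add_distrib, ← Finset.mul_sum, sum_card_outLetters, Finset.sum_const,
      smul_eq_mul] at h
    omega
  · rw [← sum_card_outLetters, ← Finset.card_sigma, ← Finset.card_range K, ← Finset.card_product]
    have hK' : ∀ v x, ∃ (k : ℕ) (d : X × (α × Bool)), edgeOf v x ∈ S → k < K ∧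
        Follow S k (v, x) d ∧ edgeOf d.1 d.2 ∈ S ∧
        3 ≤ (outLetters S (step d.1 d.2)).card := by
      intro v x
      by_cases hx : edgeOf v x ∈ S
      · obtain ⟨k, hk, d, hd⟩ := hK v x hx
        exact ⟨k, d, fun _ => ⟨hk, hd⟩⟩
      · exact ⟨0, (v, x), fun h => absurd h hx⟩
    choose k d hkd using hK'
    -- an oriented edge is determined by the end of its arc, reversed, and the number of steps
    refine Finset.card_le_card_of_injOn (fun p => (⟨step (d p.1 p.2).1 (d p.1 p.2).2,
      invLetter (d p.1 p.2).2⟩, k p.1 p.2)) ?_ ?_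
    · rintro ⟨v, x⟩ h
      have hx := mem_outLetters.1 (Finset.mem_sigma.1 (Finset.mem_coe.1 h)).2
      have hs := (hkd v x hx).2.2.1
      rw [← edgeOf_step_invLetter] at hs
      exact Finset.mem_coe.2 (Finset.mem_product.2 ⟨Finset.mem_sigma.2
        ⟨Finset.mem_filter.2 ⟨mem_vertices.2 ⟨_, hs⟩, (hkd v x hx).2.2.2⟩, mem_outLetters.2 hs⟩,
        Finset.mem_range.2 ((hkd v x hx).1)⟩)
    · rintro ⟨v, x⟩ h ⟨v', x'⟩ h' heq
      have hx := mem_outLetters.1 (Finset.mem_sigma.1 (Finset.mem_coe.1 h)).2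
      have hx' := mem_outLetters.1 (Finset.mem_sigma.1 (Finset.mem_coe.1 h')).2
      simp only [Prod.mk.injEq, Sigma.mk.injEq, heq_eq_eq] at heq
      obtain ⟨⟨h1, h2⟩, h3⟩ := heq
      have h4 : (d v x).2 = (d v' x').2 := by
        rw [← invLetter_invLetter (d v x).2, h2, invLetter_invLetter]
      have h5 : d v x = d v' x' := by
        refine Prod.ext ?_ h4
        rw [← step_step_invLetter (d v x).1 (d v x).2, h1, h4, step_step_invLetter]
      have h6 := (hkd v x hx).2.1
      rw [h3, h5] at h6
      have h7 := h6.injective (hkd v' x' hx').2.1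
      simp only [Prod.mk.injEq] at h7
      rw [h7.1, h7.2]

end Arcs

/-! ### The subgraph traversed by a loop -/

section LoopSubgraph

variable {α X : Type*} [MulAction (FreeGroup α) X]

theorem mem_edges {v : X} {l : List (α × Bool)} {e : X × α} :
    e ∈ edges v l ↔ ∃ p x q, l = p ++ x :: q ∧ e = edgeOf ((mk p)⁻¹ • v) x := by
  constructor
  · intro h
    induction l generalizing v with
    | nil => simp [edges] at h
    | cons x l ih =>
      rcases List.mem_cons.1 h with h | h
      · exact ⟨[], x, l, rfl, by rw [h, ← one_eq_mk, inv_one, one_smul]⟩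
      · obtain ⟨p, y, q, rfl, he⟩ := ih h
        exact ⟨x :: p, y, q, rfl, by rw [he, mk_cons_inv_smul]⟩
  · rintro ⟨p, x, q, rfl, rfl⟩
    rw [edges_append]
    exact List.mem_append_right _ (List.mem_cons_self ..)

/-- A loop may be read from any of its vertices, along a cyclic permutation of its label. -/
theorem rotate_loop {o : X} {p s : List (α × Bool)} (h : (mk (p ++ s))⁻¹ • o = o) :
    (mk (s ++ p))⁻¹ • (mk p)⁻¹ • o = (mk p)⁻¹ • o ∧
      ∀ e ∈ edges ((mk p)⁻¹ • o) (s ++ p), e ∈ edges o (p ++ s) := by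
  have h' : (mk s)⁻¹ • (mk p)⁻¹ • o = o := by
    rw [← mul_smul, ← mul_inv_rev, mul_mk, h]
  constructor
  · rw [← mul_mk, mul_inv_rev, mul_smul, h']
  · intro e he
    rw [edges_append, h', List.mem_append] at he
    rw [edges_append, List.mem_append]
    exact he.symm

theorem invRev_loop {o : X} {l : List (α × Bool)} (h : (mk l)⁻¹ • o = o) :
    (mk (invRev l))⁻¹ • o = o ∧ ∀ e ∈ edges o (invRev l), e ∈ edges o l := by
  constructor
  · rw [← inv_mk, inv_inv]
    nth_rewrite 1 [← h]
    rw [smul_inv_smul]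
  · intro e he
    have h1 := edges_invRev o l
    rw [h] at h1
    rwa [h1, List.mem_reverse] at he

/-- If the loop `p y q` at `o` traverses the edge at `v` labelled `x`, then so it does, in the
direction of `x`, when read forwards or backwards. -/
theorem orient_occurrence {o v : X} {x y : α × Bool} {p q : List (α × Bool)}
    (hL : (mk (p ++ y :: q))⁻¹ • o = o) (he : edgeOf v x = edgeOf ((mk p)⁻¹ • o) y) :
    (v = (mk p)⁻¹ • o ∧ x = y) ∨ (v = (mk (invRev q))⁻¹ • o ∧
      invRev (p ++ y :: q) = invRev q ++ x :: invRev p) := by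
  rcases eq_or_of_edgeOf_eq he.symm with ⟨h1, h2⟩ | ⟨h1, h2⟩
  · exact .inl ⟨h1.symm, h2.symm⟩
  · refine .inr ⟨?_, ?_⟩
    · rw [← mul_mk, mul_inv_rev, mul_smul, mk_cons_inv_smul, ← h1] at hL
      rw [← inv_mk, inv_inv, ← hL, smul_inv_smul]
    · rw [h2, invRev_append, invRev_cons, List.append_assoc]
      rfl

theorem ne_of_not_isProperPower {p q p' q' : List (α × Bool)} {x : α × Bool}
    (h : p ++ x :: q = p' ++ x :: q') (hpow : ¬ IsProperPower (mk (p ++ x :: q)))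
    (hlen : p.length ≠ p'.length) : q ++ p ≠ q' ++ p' := by
  intro hrot
  rcases lt_or_gt_of_ne hlen with hl | hl
  · exact hpow (isProperPower_of_rotation_eq h (by simp [hrot]) hl (by simp))
  · exact hpow (h ▸ isProperPower_of_rotation_eq h.symm (by simp [hrot]) hl (by simp))

/-- Let `L` be a loop that is not a proper power and that crosses each of its edges more than once.
Then each oriented edge of its image is the start of two distinct cyclic permutations of
`L` and `L⁻¹`, both read within that image. -/
theorem exists_two_loops {o : X} {L : List (α × Bool)} (hred : IsReduced L)
    (hL : (mk L)⁻¹ • o = o) (hpow : ¬ IsProperPower (mk L))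
    (hcross : ∀ p x q, L = p ++ x :: q → edgeOf ((mk p)⁻¹ • o) x ∈ edges o p ∨
      edgeOf ((mk p)⁻¹ • o) x ∈ edges (step ((mk p)⁻¹ • o) x) q)
    {v : X} {x : α × Bool} (hx : edgeOf v x ∈ edges o L) :
    ∃ u u', u ≠ u' ∧ (mk (x :: u))⁻¹ • v = v ∧
      (∀ e ∈ edges v (x :: u), e ∈ edges o L) ∧ (∀ e ∈ edges v (x :: u'), e ∈ edges o L) ∧
      ((x :: u) ~r L ∨ (x :: u) ~r invRev L) ∧ ((x :: u') ~r L ∨ (x :: u') ~r invRev L) := by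
  obtain ⟨p, y, q, hpq, he⟩ := mem_edges.1 hx
  obtain ⟨p', y', q', hpq', he', hlen⟩ : ∃ p' y' q', L = p' ++ y' :: q' ∧
      edgeOf v x = edgeOf ((mk p')⁻¹ • o) y' ∧ p.length ≠ p'.length := by
    rcases hcross p y q hpq with h | h
    · obtain ⟨a, z, b, rfl, hz⟩ := mem_edges.1 h
      exact ⟨a, z, b ++ y :: q, by rw [hpq]; simp, he.trans hz, by simp⟩
    · obtain ⟨a, z, b, rfl, hz⟩ := mem_edges.1 h
      refine ⟨p ++ y :: a, z, b, by rw [hpq]; simp, he.trans (hz.trans ?_), by simp⟩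
      rw [← mul_mk (L₁ := p), mul_inv_rev, mul_smul, mk_cons_inv_smul]
  have hfwd : ∀ {p q}, L = p ++ x :: q → v = (mk p)⁻¹ • o →
      (mk (x :: (q ++ p)))⁻¹ • v = v ∧ (∀ e ∈ edges v (x :: (q ++ p)), e ∈ edges o L) ∧
        (x :: (q ++ p)) ~r L := by
    rintro p q rfl rfl
    obtain ⟨h1, h2⟩ := rotate_loop hL
    exact ⟨h1, h2, List.isRotated_append (l := x :: q)⟩
  have hbwd : ∀ {p q}, invRev L = p ++ x :: q → v = (mk p)⁻¹ • o →
      (mk (x :: (q ++ p)))⁻¹ • v = v ∧ (∀ e ∈ edges v (x :: (q ++ p)), e ∈ edges o L) ∧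
        (x :: (q ++ p)) ~r invRev L := by
    rintro p q h rfl
    obtain ⟨h1, h2⟩ := invRev_loop hL
    rw [h] at h1
    obtain ⟨h3, h4⟩ := rotate_loop h1
    exact ⟨h3, fun e he => h2 e (h ▸ h4 e he), h ▸ List.isRotated_append (l := x :: q)⟩
  have hinv : ∀ {u u'}, (x :: u) ~r L → (x :: u') ~r invRev L → u ≠ u' := by
    rintro u u' h h' rfl
    exact not_isRotated_invRev hred (by rw [hpq]; simp) (h.symm.trans h')
  have hpow' : ¬ IsProperPower (mk (invRev L)) := by
    rintro ⟨g, n, hn, h⟩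
    exact hpow ⟨g⁻¹, n, hn, by rw [inv_pow, ← h, inv_mk, invRev_invRev]⟩
  rcases orient_occurrence (hpq ▸ hL) he with ⟨hv, rfl⟩ | ⟨hv, hb⟩ <;>
    rcases orient_occurrence (hpq' ▸ hL) he' with ⟨hv', rfl⟩ | ⟨hv', hb'⟩
  · obtain ⟨h1, h2, h3⟩ := hfwd hpq hv
    obtain ⟨-, h2', h3'⟩ := hfwd hpq' hv'
    exact ⟨_, _, ne_of_not_isProperPower (hpq ▸ hpq') (hpq ▸ hpow) hlen, h1, h2, h2', .inl h3,
      .inl h3'⟩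
  · rw [← hpq'] at hb'
    obtain ⟨h1, h2, h3⟩ := hfwd hpq hv
    obtain ⟨-, h2', h3'⟩ := hbwd hb' hv'
    exact ⟨_, _, hinv h3 h3', h1, h2, h2', .inl h3, .inr h3'⟩
  · rw [← hpq] at hb
    obtain ⟨h1, h2, h3⟩ := hbwd hb hv
    obtain ⟨-, h2', h3'⟩ := hfwd hpq' hv'
    exact ⟨_, _, (hinv h3' h3).symm, h1, h2, h2', .inr h3, .inl h3'⟩
  · rw [← hpq] at hb
    rw [← hpq'] at hb'
    obtain ⟨h1, h2, h3⟩ := hbwd hb hv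
    obtain ⟨-, h2', h3'⟩ := hbwd hb' hv'
    refine ⟨_, _, ne_of_not_isProperPower (hb ▸ hb') (hb ▸ hpow') ?_, h1, h2, h2', .inr h3,
      .inr h3'⟩
    have h4 := congrArg List.length hpq
    rw [hpq'] at h4
    simp only [List.length_append, List.length_cons, invRev_length] at h4 ⊢
    omega

/-- The image of a loop is a connected graph. -/
theorem connected_subgraph_edges {α X : Type} [MulAction (FreeGroup α) X] {o : X}
    {L : List (α × Bool)} {S : Set (X × α)} (hS : ∀ e, e ∈ S ↔ e ∈ edges o L)
    (hL : (mk L)⁻¹ • o = o) (ho : ∃ x, edgeOf o x ∈ S) : (subgraph S).Connected := by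
  have key : ∀ v : (subgraph S).Vertex, Nonempty ((subgraph S).EdgePath ⟨o, ho⟩ v) := by
    intro v
    obtain ⟨x, hx⟩ := v.2
    obtain ⟨p, y, q, rfl, he⟩ := mem_edges.1 ((hS _).1 hx)
    obtain ⟨l, hl, hlS⟩ : ∃ l, v.1 = (mk l)⁻¹ • o ∧ ∀ e ∈ edges o l, e ∈ S := by
      rcases orient_occurrence hL he with ⟨h, -⟩ | ⟨h, h'⟩
      · exact ⟨p, h, fun e he => (hS e).2 (by rw [edges_append]; simp [he])⟩
      · refine ⟨invRev q, h, fun e he => (hS e).2 ((invRev_loop hL).2 e ?_)⟩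
        rw [h', edges_append]
        simp [he]
    obtain ⟨v', c, hv', -⟩ := exists_edgePath (S := S) ⟨o, ho⟩ l hlS
    obtain rfl : v' = v := Subtype.ext (hv'.trans hl.symm)
    exact ⟨c⟩
  exact ⟨⟨⟨o, ho⟩⟩, fun u v => ⟨(key u).some.reverse.comp (key v).some⟩⟩

theorem isCyclicallyReduced_of_mem_symmetrizedClosure {L u : List (α × Bool)}
    (hL : IsCyclicallyReduced L) (hu : u ~r L ∨ u ~r invRev L) : IsCyclicallyReduced u := by
  have key : ∀ L : List (α × Bool), IsCyclicallyReduced L → u ~r L → IsCyclicallyReduced u := by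
    intro L hL h
    obtain ⟨n, rfl⟩ := h.symm
    rw [← List.rotate_mod]
    rcases L.eq_nil_or_concat with rfl | ⟨l, z, rfl⟩
    · simp
    · rw [List.rotate_eq_drop_append_take (Nat.mod_lt _ (by simp)).le]
      exact isCyclicallyReduced_append_comm (by rwa [List.take_append_drop])
  rcases hu with hu | hu
  · exact key _ hL hu
  · exact key _ (isCyclicallyReduced_invRev hL) hu

end LoopSubgraph

/-- If a loop labelled by a cyclically reduced word `L` satisfying `C'(lam)` crosses each of its
edges more than once, then the arcs of its image are pieces, and so the number of edges of the
image is bounded in terms of `lam * L.length` and the Euler characteristic. -/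
theorem exists_card_edges_loop_le {α X : Type} [MulAction (FreeGroup α) X] [Fintype α]
    [DecidableEq α] [DecidableEq X] {o : X} {L : List (α × Bool)} {lam : ℝ} {S : Finset (X × α)}
    (hS : ∀ e, e ∈ S ↔ e ∈ edges o L) (hc : IsCyclicallyReduced L)
    (hL : (mk L)⁻¹ • o = o) (hpow : ¬ IsProperPower (mk L))
    (hlam : SmallCancellation lam (symmetrizedClosure L))
    (hcross : ∀ p x q, L = p ++ x :: q → edgeOf ((mk p)⁻¹ • o) x ∈ edges o p ∨
      edgeOf ((mk p)⁻¹ • o) x ∈ edges (step ((mk p)⁻¹ • o) x) q) :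
    ∃ B K : ℕ, (K : ℝ) ≤ lam * L.length ∧ B + 6 * (vertices S).card ≤ 6 * S.card ∧
      2 * S.card ≤ B * K := by
  by_cases hS0 : S = ∅
  · have : L = [] := by
      cases L with
      | nil => rfl
      | cons x l => simpa [hS0] using (hS (edgeOf o x)).2 (by simp [edges])
    exact ⟨0, 0, by simp [this], by simp [hS0, vertices], by simp [hS0]⟩
  have hlen : ∀ u, u ~r L ∨ u ~r invRev L → u.length = L.length := by
    rintro u (h | h)
    · exact h.perm.length_eq
    · rw [h.perm.length_eq, invRev_length]
  have hloops := fun v x (hx : edgeOf v x ∈ S) =>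
    exists_two_loops hc.isReduced hL hpow hcross ((hS _).1 hx)
  have hKex : ∀ v x, edgeOf v x ∈ S → ∃ k < ⌊lam * L.length⌋₊, ∃ d, Follow S k (v, x) d ∧
      edgeOf d.1 d.2 ∈ S ∧ 3 ≤ (outLetters S (step d.1 d.2)).card := by
    intro v x hx
    obtain ⟨u, u', hne, -, hu, hu', hc1, hc2⟩ := hloops v x hx
    have hl1 := hlen _ hc1
    have hl2 := hlen _ hc2
    obtain ⟨k, d, c, h1, h2, h3, h4, h5, h6⟩ := exists_follow_of_ne
      (isCyclicallyReduced_of_mem_symmetrizedClosure hc hc1).isReduced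
      (isCyclicallyReduced_of_mem_symmetrizedClosure hc hc2).isReduced
      (by simpa using hl1.trans hl2.symm) hne (fun e he => (hS e).2 (hu e he))
      (fun e he => (hS e).2 (hu' e he))
    refine ⟨k, ?_, d, h1, h2, h3⟩
    have := hlam _ hc1 c h5 ⟨_, hc1, _, hc2, by simpa using hne, h5, h6⟩
    rw [h4, hl1] at this
    exact Nat.lt_of_succ_le (Nat.le_floor this.le)
  have hdeg : ∀ v ∈ vertices S, 2 ≤ (outLetters S v).card := by
    intro v hv
    obtain ⟨x, hx⟩ := mem_vertices.1 hv
    obtain ⟨u, -, -, hloop, hu, -, hc1, -⟩ := hloops v x hx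
    have hred := isReduced_append_self (isCyclicallyReduced_of_mem_symmetrizedClosure hc hc1)
    obtain ⟨c, z, hcz⟩ : ∃ c z, x :: u = c ++ [z] :=
      ⟨_, _, (List.dropLast_append_getLast (List.cons_ne_nil x u)).symm⟩
    have hne : x ≠ invLetter z := by
      apply isReduced_pair_iff.1
      refine hred.infix ⟨c, u, ?_⟩
      simpa using congrArg (· ++ x :: u) hcz.symm
    have hz : edgeOf v (invLetter z) ∈ S := by
      rw [hcz, edges_append] at hu
      have h1 := (hS _).2 (hu (edgeOf ((mk c)⁻¹ • v) z) (by simp [edges]))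
      rw [hcz, ← mul_mk, mul_inv_rev, mul_smul] at hloop
      rw [← edgeOf_step_invLetter] at h1
      rwa [step, hloop] at h1
    have := Finset.card_le_card (s := {x, invLetter z}) (t := outLetters S v) (by
      intro y hy
      simp only [Finset.mem_insert, Finset.mem_singleton] at hy
      rcases hy with rfl | rfl
      · exact mem_outLetters.2 hx
      · exact mem_outLetters.2 hz)
    rwa [Finset.card_pair hne] at this
  obtain ⟨B, h1, h2⟩ := exists_card_edges_le S _ hdeg hKex
  have hpos : 0 ≤ lam * L.length := by
    by_contra hneg
    obtain ⟨e, he⟩ := Finset.nonempty_iff_ne_empty.2 hS0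
    obtain ⟨k, hk, -⟩ := hKex e.1 (e.2, true) he
    rw [Nat.floor_of_nonpos (not_le.1 hneg).le] at hk
    omega
  exact ⟨B, _, Nat.floor_le hpos, h1, h2⟩

/-! ### Subgroups of small rank -/

/-- A word `w` satisfying the `(lam, μ, r)`-condition is primitive in every proper subgroup of rank
at most `r` that contains it: otherwise its loop in the Schreier graph crosses each edge of its
image more than once, so that the image is a short graph of rank at most `r`. -/
theorem eq_top_of_containsNonprimitively {r : ℕ} (hr : 2 ≤ r) {lam μ : ℝ}
    (hlam : lam < μ / (3 * r))
    {w : FreeGroup (Fin r)} (hw1 : w ≠ 1) (hw : w ∈ setP r lam μ r)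
    {H : Subgroup (FreeGroup (Fin r))} (hH : ContainsNonprimitively H w) (hHr : freeRank H ≤ r) :
    H = ⊤ := by
  classical
  obtain ⟨hc, hsc, hpow, hread⟩ := hw
  obtain ⟨hwH, hprim⟩ := hH
  set L := w.toWord with hLdef
  have hLw : mk L = w := mk_toWord
  have hL0 : L ≠ [] := fun h => hw1 (toWord_eq_nil_iff.1 h)
  set o : FreeGroup (Fin r) ⧸ H := ((1 : FreeGroup (Fin r)) : FreeGroup (Fin r) ⧸ H) with ho_def
  have hfix : ∀ h : FreeGroup (Fin r), h • o = o ↔ h ∈ H :=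
    fun _ => smul_coe_one_eq_iff
  have hL : (mk L)⁻¹ • o = o := (hfix _).2 (H.inv_mem (hLw ▸ hwH))
  have hcross : ∀ p x q, L = p ++ x :: q → edgeOf ((mk p)⁻¹ • o) x ∈ edges o p ∨
      edgeOf ((mk p)⁻¹ • o) x ∈ edges (step ((mk p)⁻¹ • o) x) q := by
    intro p x q h
    by_contra hne
    rw [not_or] at hne
    rw [h] at hLw
    subst hLw
    exact hprim (isPrimitive_of_edge_crossed_once hwH hne.1 hne.2)
  set S := (edges o L).toFinset
  have hS : ∀ e, e ∈ S ↔ e ∈ edges o L := fun e => List.mem_toFinset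
  have ho : ∃ x, edgeOf o x ∈ S := by
    obtain ⟨x, l, hxl⟩ := List.exists_cons_of_ne_nil hL0
    exact ⟨x, (hS _).2 (by rw [hxl]; simp [edges])⟩
  obtain ⟨B, K, hK, hB, hBK⟩ :=
    exists_card_edges_loop_le hS hc hL (hLw ▸ hpow) hsc hcross
  have hrank : S.card + 1 ≤ (vertices S).card + r := by
    refine card_edges_add_one_le hHr S _ (fun e he => ?_) (mem_vertices.2 ho)
    exact ⟨mem_vertices.2 ⟨(e.2, true), he⟩,
      mem_vertices.2 ⟨invLetter (e.2, true), by rwa [edgeOf_step_invLetter]⟩⟩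
  have hfew : (S.card : ℝ) ≤ μ * L.length := by
    have hr0 : (0 : ℝ) < r := by exact_mod_cast (by omega : 0 < r)
    have h1 : (B : ℝ) ≤ 6 * r := by exact_mod_cast (by omega : B ≤ 6 * r)
    have h2 : (2 : ℝ) * S.card ≤ B * K := by exact_mod_cast hBK
    have h3 : lam * (3 * r) ≤ μ := ((lt_div_iff₀ (by positivity)).1 hlam).le
    have h4 : (B : ℝ) * K ≤ 6 * r * (lam * L.length) :=
      mul_le_mul h1 hK (by positivity) (by positivity)
    have h5 : lam * (3 * r) * L.length ≤ μ * L.length :=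
      mul_le_mul_of_nonneg_right h3 (by positivity)
    linarith
  -- all vertices have full degree, or else `w` would be readable
  have hfull : ∀ v ∈ vertices S, ∀ x, edgeOf v x ∈ S := by
    intro v hv x
    by_contra hx
    refine (hread L L (List.IsRotated.refl L) (List.infix_refl L) ?_).2 ?_
    · have : (0 : ℝ) ≤ L.length := by positivity
      linarith
    let T : Set ((FreeGroup (Fin r) ⧸ H) × Fin r) := ↑S
    have hconn : (subgraph T).Connected :=
      connected_subgraph_edges hS hL ho
    let o' : (subgraph T).Vertex := ⟨o, ho⟩
    obtain ⟨y, p, -, hp⟩ := exists_edgePath o' L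
      (fun e he => Finset.mem_coe.2 ((hS e).2 he))
    refine ⟨subgraph T, hconn, folded_subgraph, ⟨S.card, ?_, hfew⟩,
      ⟨o', y, p, (freeRank_fundamentalGroup_le hconn o' rfl).trans hHr, hp⟩,
      ⟨v, mem_vertices.1 hv⟩, ?_⟩
    · rw [numEdges_subgraph]
      change ENat.card (↑S : Set ((FreeGroup (Fin r) ⧸ H) × Fin r)) = _
      rw [ENat.card_coe_set_eq, Set.encard_coe_eq_coe_finsetCard]
    · have h := degree_subgraph_lt (S := T)
        (u := ⟨v, mem_vertices.1 hv⟩) (x := x)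
        hx
      rwa [Fintype.card_fin] at h
  -- hence there is only one vertex, by the Euler characteristic
  have hcard : (vertices S).card = 1 := by
    have h1 := sum_card_outLetters S
    have h2 : ∀ v ∈ vertices S, (outLetters S v).card = 2 * r := by
      intro v hv
      have : outLetters S v = Finset.univ :=
        Finset.eq_univ_iff_forall.2 fun x => mem_outLetters.2 (hfull v hv x)
      rw [this, Finset.card_univ]
      simp [mul_comm]
    rw [Finset.sum_congr rfl h2, Finset.sum_const, smul_eq_mul] at h1
    -- `V * (2 * r) = 2 * E` and `E + 1 ≤ V + r` give `(V - 1) * (r - 1) ≤ 0`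
    have h3 : 0 < (vertices S).card := Finset.card_pos.2 ⟨o, mem_vertices.2 ho⟩
    nlinarith
  obtain ⟨o', ho'⟩ := Finset.card_eq_one.1 hcard
  have hoo' : o = o' := Finset.mem_singleton.1 (ho' ▸ mem_vertices.2 ho)
  rw [eq_top_iff, ← FreeGroup.closure_range_of, Subgroup.closure_le]
  rintro _ ⟨a, rfl⟩
  have h1 : edgeOf o (a, false) ∈ S := hfull o (mem_vertices.2 ho) _
  have h2 : step o (a, false) ∈ vertices S :=
    mem_vertices.2 ⟨invLetter (a, false), by rwa [edgeOf_step_invLetter]⟩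
  rw [ho', Finset.mem_singleton, ← hoo', step_false] at h2
  exact (hfix _).1 h2

theorem freeRank_top (r : ℕ) : freeRank (⊤ : Subgroup (FreeGroup (Fin r))) = r := by
  rw [freeRank_eq ((FreeGroupBasis.ofFreeGroup (Fin r)).map Subgroup.topEquiv.symm)]
  simp

theorem containsNonprimitively_top {G : Type u} [Group G] {g : G} (hg : ¬ IsPrimitive g) :
    ContainsNonprimitively (⊤ : Subgroup G) g := by
  refine ⟨Subgroup.mem_top g, ?_⟩
  rintro ⟨ι, b, i, hi⟩
  exact hg ⟨ι, b.map Subgroup.topEquiv, i, by rw [FreeGroupBasis.map_apply, hi]; rfl⟩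

end PrimitivityRank

open PrimitivityRank

theorem mainTheorem2 (r : ℕ) (hr : 2 ≤ r) (lam μ : ℝ)
    (hlam0 : 0 < lam) (hlam1 : lam < 1) (hμ0 : 0 < μ) (hμ1 : μ < 1)
    (h₁ : lam ≤ μ / (15 * r + 3 * μ)) (h₂ : μ / (15 * r + 3 * μ) < 1 / 6)
    (h₃ : lam < μ / (3 * r))
    (w : FreeGroup (Fin r)) (hw1 : w ≠ 1)
    (hwc : FreeGroup.IsCyclicallyReduced w.toWord)
    (hw : w ∈ PrimitivityRank.setP' r lam μ r) :
    PrimitivityRank.primitivityRank w = (r : ℕ∞) ∧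
      PrimitivityRank.criticalSet w = {(⊤ : Subgroup (FreeGroup (Fin r)))} := by
  have : Nontrivial (Fin r) := Fin.nontrivial_iff_two_le.2 hr
  have htop : ContainsNonprimitively (⊤ : Subgroup (FreeGroup (Fin r))) w :=
    containsNonprimitively_top (not_isPrimitive_of_two_letter_words hwc hw.2)
  have hH : ∀ H : Subgroup (FreeGroup (Fin r)), ContainsNonprimitively H w → freeRank H ≤ r →
      H = ⊤ := fun H h hHr => eq_top_of_containsNonprimitively hr h₃ hw1 hw.1 h hHr
  have hrank : primitivityRank w = (r : ℕ∞) := by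
    refine le_antisymm (sInf_le ⟨⊤, htop, freeRank_top r⟩) (le_sInf ?_)
    rintro _ ⟨H, h, rfl⟩
    by_contra hlt
    obtain rfl := hH H h (not_le.1 hlt).le
    exact hlt (freeRank_top r).ge
  refine ⟨hrank, ?_⟩
  ext H
  simp only [criticalSet, hrank, Set.mem_ofPred_eq, Set.mem_singleton_iff]
  constructor
  · rintro ⟨h, hHr⟩
    exact hH H h hHr.le
  · rintro rfl
    exact ⟨htop, freeRank_top r⟩
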